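/- Let $p$ be a prime and let $d,u$ be positive integers, with $u\ge 2$ if $p=2$. For $i\ge 1$ let $\Gamma(i)=\{A\in \mathrm{Mat}_d(\mathbb{Z}_p) : A\equiv I_d \bmod p^{i}\}$ be the congruence subgroup of level $p^{i}$ in $\mathrm{GL}_d(\mathbb{Z}_p)$, put $\Gamma=\Gamma(u)$ and $e=d^2$. Let $k$ be a field of characteristic $p$. For a normal subgroup $N$ of $\Gamma$ let $\omega(N)k[\Gamma]$ be the kernel of the natural map $k[\Gamma]\to k[\Gamma/N]$, i.e. the ideal of the group algebra $k[\Gamma]$ generated by the elements $g-1$, $g\in N$. Let $$k[[\Gamma]]=\varprojlim_{n\ge 0} k[\Gamma]/\omega(\Gamma(u+n))k[\Gamma]$$ be the completed group algebra, with the inverse limit topology in which every $k[\Gamma]/\omega(\Gamma(u+n))k[\Gamma]$ is discrete, and let $\overline{\omega}(\Gamma)$ be the closure in $k[[\Gamma]]$ of the augmentation ideal $\omega(\Gamma)$ of $k[\Gamma]$. (a) The powers of $\overline{\omega}(\Gamma)$ have zero intersection, and the associated graded ring $$\mathrm{gr}(k[[\Gamma]])=\bigoplus_{i=0}^{\infty}\overline{\omega}(\Gamma)^i/\overline{\omega}(\Gamma)^{i+1}$$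 is isomorphic, as a graded $k$-algebra, to the polynomial ring over $k$ in $e$ variables, graded by total degree. (b) The completed group algebra $k[[\Gamma]]$ is a (left and right) noetherian domain. -/

import Mathlib

noncomputable section

/-! ### Congruence subgroups -/

/-- The congruence subgroup `{A ∈ Mat_d(ℤ_p) ∣ A ≡ 1 mod p ^ i}`, as the kernel of the reduction
`GL_d(ℤ_p) → GL_d(ℤ/p^i)`. For `i ≥ 1` every matrix congruent to `1` modulo `p ^ i` is invertible,
see `exists_mem_congruenceSubgroup`. -/
def congruenceSubgroup (p d : ℕ) [Fact p.Prime] (i : ℕ) :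
    Subgroup (Matrix.GeneralLinearGroup (Fin d) ℤ_[p]) :=
  (Matrix.GeneralLinearGroup.map (n := Fin d) (PadicInt.toZModPow (p := p) i)).ker

instance congruenceSubgroup_normal (p d : ℕ) [Fact p.Prime] (i : ℕ) :
    (congruenceSubgroup p d i).Normal :=
  inferInstanceAs (MonoidHom.ker _).Normal

theorem toZModPow_eq_zero_iff (p : ℕ) [Fact p.Prime] (i : ℕ) (x : ℤ_[p]) :
    PadicInt.toZModPow i x = 0 ↔ (p : ℤ_[p]) ^ i ∣ x := by
  rw [← RingHom.mem_ker, PadicInt.ker_toZModPow, Ideal.mem_span_singleton]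

theorem mem_congruenceSubgroup_iff (p d : ℕ) [Fact p.Prime] (i : ℕ)
    (g : Matrix.GeneralLinearGroup (Fin d) ℤ_[p]) :
    g ∈ congruenceSubgroup p d i ↔
      ∀ a b, (p : ℤ_[p]) ^ i ∣ ((g : Matrix (Fin d) (Fin d) ℤ_[p]) - 1) a b := by
  simp_rw [← toZModPow_eq_zero_iff]
  rw [congruenceSubgroup, MonoidHom.mem_ker, Matrix.GeneralLinearGroup.ext_iff]
  refine forall_congr' fun a => forall_congr' fun b => ?_
  by_cases h : a = b <;> simp [h, sub_eq_zero]

theorem exists_mem_congruenceSubgroup (p d : ℕ) [Fact p.Prime] (i : ℕ) (hi : 0 < i)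
    (A : Matrix (Fin d) (Fin d) ℤ_[p]) (hA : ∀ a b, (p : ℤ_[p]) ^ i ∣ (A - 1) a b) :
    ∃ g ∈ congruenceSubgroup p d i, (g : Matrix (Fin d) (Fin d) ℤ_[p]) = A := by
  have h1 : (PadicInt.toZModPow (p := p) i).mapMatrix A = 1 := by
    rw [← sub_eq_zero, ← map_one (PadicInt.toZModPow (p := p) i).mapMatrix, ← map_sub]
    ext a b
    exact (toZModPow_eq_zero_iff p i _).2 (hA a b)
  have h2 : PadicInt.toZModPow (p := p) i (A.det - 1) = 0 := by
    rw [map_sub, RingHom.map_det, h1]; simp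
  have h3 : IsUnit A.det := by
    by_contra hu
    have h4 : A.det ∈ IsLocalRing.maximalIdeal ℤ_[p] := hu
    have h5 : A.det - 1 ∈ IsLocalRing.maximalIdeal ℤ_[p] := by
      rw [PadicInt.maximalIdeal_eq_span_p, Ideal.mem_span_singleton]
      exact (dvd_pow_self _ hi.ne').trans ((toZModPow_eq_zero_iff p i _).1 h2)
    have h6 := Ideal.sub_mem _ h4 h5
    rw [sub_sub_cancel] at h6
    exact (Ideal.ne_top_iff_one _).1 (IsLocalRing.maximalIdeal.isMaximal ℤ_[p]).ne_top h6
  refine ⟨Matrix.GeneralLinearGroup.mk'' A h3, ?_, rfl⟩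
  rw [mem_congruenceSubgroup_iff]
  exact hA

theorem congruenceSubgroup_antitone (p d : ℕ) [Fact p.Prime] :
    Antitone (congruenceSubgroup p d) := by
  intro m n h g hg
  rw [mem_congruenceSubgroup_iff] at hg ⊢
  exact fun a b => (pow_dvd_pow _ h).trans (hg a b)

/-! ### Completion along a descending sequence of two-sided ideals -/

section Completion

variable (F : Type*) {R : Type*} [CommRing F] [Ring R] [Algebra F R]
  (I : ℕ → Ideal R) [∀ n, (I n).IsTwoSided] (hI : Antitone I)

/-- The inverse limit of the `R ⧸ I n`, as a subalgebra of their product. -/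
def completionSubalgebra : Subalgebra F (∀ n, R ⧸ I n) where
  carrier := {x | ∀ m n, ∀ h : m ≤ n, Ideal.Quotient.factor (hI h) (x n) = x m}
  mul_mem' hx hy m n h := by simp [hx m n h, hy m n h]
  add_mem' hx hy m n h := by simp [hx m n h, hy m n h]
  algebraMap_mem' _ _ _ _ := rfl

/-- The completion `lim R ⧸ I n` of the `F`-algebra `R` along the descending sequence `I`. -/
def Completion : Type _ := completionSubalgebra F I hI

namespace Completion

instance : Ring (Completion F I hI) := inferInstanceAs (Ring (completionSubalgebra F I hI))

instance : Algebra F (Completion F I hI) :=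
  inferInstanceAs (Algebra F (completionSubalgebra F I hI))

/-- The projection of the completion onto `R ⧸ I n`. -/
def proj (n : ℕ) : Completion F I hI →ₐ[F] R ⧸ I n :=
  (Pi.evalAlgHom F (fun n => R ⧸ I n) n).comp (completionSubalgebra F I hI).val

/-- The canonical homomorphism from `R` to its completion. -/
def of : R →ₐ[F] Completion F I hI :=
  AlgHom.codRestrict (AlgHom.pi fun n => Ideal.Quotient.mkₐ F (I n))
    (completionSubalgebra F I hI) fun _ _ _ _ => rfl

/-- The inverse limit topology, each `R ⧸ I n` being discrete: the coarsest topology for which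
all projections to the discrete rings `R ⧸ I n` are continuous. -/
instance : TopologicalSpace (Completion F I hI) :=
  ⨅ n, TopologicalSpace.induced (proj F I hI n) ⊥

theorem proj_of (n : ℕ) (r : R) : proj F I hI n (of F I hI r) = Ideal.Quotient.mk (I n) r := rfl

theorem factor_proj {m n : ℕ} (h : m ≤ n) (x : Completion F I hI) :
    Ideal.Quotient.factor (hI h) (proj F I hI n x) = proj F I hI m x := x.2 m n h

@[ext] theorem ext {x y : Completion F I hI} (h : ∀ n, proj F I hI n x = proj F I hI n y) :
    x = y := Subtype.ext (funext h)

theorem isOpen_setOf_proj_eq (n : ℕ) (a : R ⧸ I n) : IsOpen {x | proj F I hI n x = a} := by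
  have h : TopologicalSpace.induced (proj F I hI n) ⊥ ≥
      (inferInstance : TopologicalSpace (Completion F I hI)) := iInf_le _ n
  exact h _ ⟨{a}, trivial, rfl⟩

theorem continuous_iff {X : Type*} [TopologicalSpace X] (f : X → Completion F I hI) :
    Continuous f ↔ ∀ n x, ∀ᶠ y in nhds x, proj F I hI n (f y) = proj F I hI n (f x) := by
  constructor
  · intro hf n x
    exact hf.continuousAt.eventually ((isOpen_setOf_proj_eq F I hI n _).mem_nhds rfl)
  · intro h
    refine continuous_iInf_rng.2 fun n => continuous_induced_rng.2 ?_
    let _ : TopologicalSpace (R ⧸ I n) := ⊥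
    have _ : DiscreteTopology (R ⧸ I n) := ⟨rfl⟩
    exact (IsLocallyConstant.iff_eventually_eq _).2 (h n) |>.continuous

instance : IsTopologicalRing (Completion F I hI) where
  continuous_add := by
    rw [continuous_iff]
    intro n x
    filter_upwards [continuous_fst.continuousAt.eventually
      ((isOpen_setOf_proj_eq F I hI n (proj F I hI n x.1)).mem_nhds rfl),
      continuous_snd.continuousAt.eventually
      ((isOpen_setOf_proj_eq F I hI n (proj F I hI n x.2)).mem_nhds rfl)] with y h1 h2
    simp_all
  continuous_mul := by
    rw [continuous_iff]
    intro n x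
    filter_upwards [continuous_fst.continuousAt.eventually
      ((isOpen_setOf_proj_eq F I hI n (proj F I hI n x.1)).mem_nhds rfl),
      continuous_snd.continuousAt.eventually
      ((isOpen_setOf_proj_eq F I hI n (proj F I hI n x.2)).mem_nhds rfl)] with y h1 h2
    simp_all
  continuous_neg := by
    rw [continuous_iff]
    intro n x
    filter_upwards [(isOpen_setOf_proj_eq F I hI n (proj F I hI n x)).mem_nhds rfl] with y h1
    simp_all

theorem mem_closure_iff (S : Set (Completion F I hI)) (x : Completion F I hI) :
    x ∈ closure S ↔ ∀ n, ∃ y ∈ S, proj F I hI n y = proj F I hI n x := by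
  constructor
  · intro h n
    obtain ⟨y, hy, hyS⟩ := _root_.mem_closure_iff.1 h _ (isOpen_setOf_proj_eq F I hI n _) rfl
    exact ⟨y, hyS, hy⟩
  · intro h
    choose y hyS hy using h
    have hlim : Filter.Tendsto y Filter.atTop (nhds x) := by
      rw [nhds_iInf, Filter.tendsto_iInf]
      intro n
      let _ : TopologicalSpace (R ⧸ I n) := ⊥
      have _ : DiscreteTopology (R ⧸ I n) := ⟨rfl⟩
      rw [nhds_induced, Filter.tendsto_comap_iff, nhds_discrete, Filter.tendsto_pure]
      filter_upwards [Filter.eventually_ge_atTop n] with m hm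
      simp only [Function.comp_apply]
      rw [← factor_proj F I hI hm, ← factor_proj F I hI hm, hy m]
    exact mem_closure_of_tendsto hlim (Filter.Eventually.of_forall hyS)

theorem denseRange_of : DenseRange (of F I hI) := by
  intro x
  rw [mem_closure_iff]
  intro n
  obtain ⟨r, hr⟩ := Ideal.Quotient.mk_surjective (proj F I hI n x)
  exact ⟨_, ⟨r, rfl⟩, hr⟩

/-- The closure, in the completion, of (the image of) a two-sided ideal `J` of `R`. It is an ideal
because `R` is dense in the completion. -/
def idealClosure (J : Ideal R) : Ideal (Completion F I hI) where
  carrier := closure (of F I hI '' (J : Set R))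
  zero_mem' := subset_closure ⟨0, J.zero_mem, map_zero _⟩
  add_mem' ha hb := map_mem_closure₂ continuous_add ha hb (by
    rintro _ ⟨a, ha, rfl⟩ _ ⟨b, hb, rfl⟩
    exact ⟨a + b, J.add_mem ha hb, map_add _ _ _⟩)
  smul_mem' c _ hx := map_mem_closure₂ continuous_mul (denseRange_of F I hI c) hx (by
    rintro _ ⟨a, rfl⟩ _ ⟨b, hb, rfl⟩
    exact ⟨a * b, J.mul_mem_left a hb, map_mul _ _ _⟩)

instance (J : Ideal R) [J.IsTwoSided] : (idealClosure F I hI J).IsTwoSided where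
  mul_mem_of_left {_} c hx := map_mem_closure₂ continuous_mul hx (denseRange_of F I hI c) (by
    rintro _ ⟨a, ha, rfl⟩ _ ⟨b, rfl⟩
    exact ⟨a * b, J.mul_mem_right b ha, map_mul _ _ _⟩)

end Completion

end Completion

/-! ### The associated graded algebra of a two-sided ideal -/

section Graded

variable (F : Type*) {A : Type*} [CommRing F] [Ring A] [Algebra F A] (I : Ideal A)

/-- The degree `i` component `I ^ i / I ^ (i + 1)` of the associated graded ring. -/
abbrev GrPiece (i : ℕ) : Type _ := ↥(I ^ i) ⧸ (I ^ (i + 1)).submoduleOf (I ^ i)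

/-- The class in `I ^ i / I ^ (i + 1)` of an element of `I ^ i`. -/
abbrev GrPiece.mk (i : ℕ) (a : A) (ha : a ∈ I ^ i) : GrPiece I i :=
  Submodule.Quotient.mk ⟨a, ha⟩

theorem GrPiece.mk_eq_iff {i : ℕ} {a b : A} (ha : a ∈ I ^ i) (hb : b ∈ I ^ i) :
    GrPiece.mk I i a ha = GrPiece.mk I i b hb ↔ a - b ∈ I ^ (i + 1) := by
  rw [GrPiece.mk, GrPiece.mk, Submodule.Quotient.eq]
  rfl

theorem GrPiece.exists_mk {i : ℕ} (x : GrPiece I i) :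
    ∃ (a : A) (ha : a ∈ I ^ i), x = GrPiece.mk I i a ha := by
  obtain ⟨⟨a, ha⟩, rfl⟩ := Submodule.Quotient.mk_surjective _ x
  exact ⟨a, ha, rfl⟩

theorem GrPiece.sigma_ext {i j : ℕ} (h : i = j) {a b : A} (ha : a ∈ I ^ i) (hb : b ∈ I ^ j)
    (hab : a = b) :
    (GradedMonoid.mk i (GrPiece.mk I i a ha) : GradedMonoid (GrPiece I)) =
      GradedMonoid.mk j (GrPiece.mk I j b hb) := by
  subst h hab
  rfl

theorem mem_pow_zero (a : A) : a ∈ I ^ 0 := by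
  rw [Submodule.pow_zero, Ideal.one_eq_top]
  trivial

instance : GradedMonoid.GOne (GrPiece I) where
  one := GrPiece.mk I 0 1 (mem_pow_zero I 1)

variable [I.IsTwoSided]

theorem mul_mem_pow_add {i j : ℕ} {a b : A} (ha : a ∈ I ^ i) (hb : b ∈ I ^ j) :
    a * b ∈ I ^ (i + j) := by
  rw [Ideal.IsTwoSided.pow_add]
  exact Ideal.mul_mem_mul ha hb

/-- The multiplication `I ^ i / I ^ (i + 1) × I ^ j / I ^ (j + 1) → I ^ (i + j) / I ^ (i + j + 1)`
induced by that of `A`. -/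
def GrPiece.mul {i j : ℕ} (x : GrPiece I i) (y : GrPiece I j) : GrPiece I (i + j) :=
  Quotient.liftOn₂' x y
    (fun a b => GrPiece.mk I (i + j) (a.1 * b.1) (mul_mem_pow_add I a.2 b.2))
    (by
      intro a b a' b' h h'
      have h1 := (GrPiece.mk_eq_iff I a.2 a'.2).1 (Quotient.sound' h)
      have h2 := (GrPiece.mk_eq_iff I b.2 b'.2).1 (Quotient.sound' h')
      rw [GrPiece.mk_eq_iff]
      have h3 : (a.1 * b.1 - a'.1 * b'.1) = (a.1 - a'.1) * b.1 + a'.1 * (b.1 - b'.1) := by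
        noncomm_ring
      rw [h3]
      refine Ideal.add_mem _ ?_ ?_
      · have := mul_mem_pow_add I h1 b.2
        rwa [show i + 1 + j = i + j + 1 by omega] at this
      · exact mul_mem_pow_add (j := j + 1) I a'.2 h2)

theorem GrPiece.mk_mul_mk {i j : ℕ} {a b : A} (ha : a ∈ I ^ i) (hb : b ∈ I ^ j) :
    GrPiece.mul I (GrPiece.mk I i a ha) (GrPiece.mk I j b hb) =
      GrPiece.mk I (i + j) (a * b) (mul_mem_pow_add I ha hb) := rfl

instance : GradedMonoid.GMul (GrPiece I) where
  mul := GrPiece.mul I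

instance : DirectSum.GRing (GrPiece I) where
  mul_zero {i j} x := by
    obtain ⟨a, ha, rfl⟩ := GrPiece.exists_mk I x
    exact (GrPiece.mk_eq_iff I _ _).2 (by simp)
  zero_mul {i j} x := by
    obtain ⟨a, ha, rfl⟩ := GrPiece.exists_mk I x
    exact (GrPiece.mk_eq_iff I _ _).2 (by simp)
  mul_add {i j} x y z := by
    obtain ⟨a, ha, rfl⟩ := GrPiece.exists_mk I x
    obtain ⟨b, hb, rfl⟩ := GrPiece.exists_mk I y
    obtain ⟨c, hc, rfl⟩ := GrPiece.exists_mk I z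
    exact (GrPiece.mk_eq_iff I _ _).2 (by simp [_root_.mul_add])
  add_mul {i j} x y z := by
    obtain ⟨a, ha, rfl⟩ := GrPiece.exists_mk I x
    obtain ⟨b, hb, rfl⟩ := GrPiece.exists_mk I y
    obtain ⟨c, hc, rfl⟩ := GrPiece.exists_mk I z
    exact (GrPiece.mk_eq_iff I _ _).2 (by simp [_root_.add_mul])
  one_mul := by
    rintro ⟨i, x⟩
    obtain ⟨a, ha, rfl⟩ := GrPiece.exists_mk I x
    exact GrPiece.sigma_ext I (zero_add i) _ _ (one_mul a)
  mul_one := by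
    rintro ⟨i, x⟩
    obtain ⟨a, ha, rfl⟩ := GrPiece.exists_mk I x
    exact GrPiece.sigma_ext I (add_zero i) _ _ (mul_one a)
  mul_assoc := by
    rintro ⟨i, x⟩ ⟨j, y⟩ ⟨l, z⟩
    obtain ⟨a, ha, rfl⟩ := GrPiece.exists_mk I x
    obtain ⟨b, hb, rfl⟩ := GrPiece.exists_mk I y
    obtain ⟨c, hc, rfl⟩ := GrPiece.exists_mk I z
    exact GrPiece.sigma_ext I (add_assoc i j l) _ _ (mul_assoc a b c)
  natCast n := GrPiece.mk I 0 n (mem_pow_zero I _)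
  natCast_zero := (GrPiece.mk_eq_iff I _ _).2 (by simp)
  natCast_succ n := (GrPiece.mk_eq_iff I _ _).2 (by simp)
  intCast n := GrPiece.mk I 0 n (mem_pow_zero I _)
  intCast_ofNat n := (GrPiece.mk_eq_iff I _ _).2 (by simp)
  intCast_negSucc_ofNat n := (GrPiece.mk_eq_iff I _ _).2 (by simp)

instance : DirectSum.GAlgebra F (GrPiece I) where
  toFun :=
    { toFun := fun c => GrPiece.mk I 0 (algebraMap F A c) (mem_pow_zero I _)
      map_zero' := (GrPiece.mk_eq_iff I _ _).2 (by simp)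
      map_add' := fun a b => (GrPiece.mk_eq_iff I _ _).2 (by simp) }
  map_one := (GrPiece.mk_eq_iff I _ _).2 (by simp)
  map_mul r s := GrPiece.sigma_ext I (zero_add 0).symm _ _ (map_mul _ r s)
  commutes := by
    rintro r ⟨i, x⟩
    obtain ⟨a, ha, rfl⟩ := GrPiece.exists_mk I x
    exact GrPiece.sigma_ext I ((zero_add i).trans (add_zero i).symm) _ _ (Algebra.commutes r a)
  smul_def := by
    rintro r ⟨i, x⟩
    obtain ⟨a, ha, rfl⟩ := GrPiece.exists_mk I x
    exact GrPiece.sigma_ext I (zero_add i).symm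
      (Submodule.smul_of_tower_mem _ r ha) _ (Algebra.smul_def r a)

/-- The associated graded ring `⨁ i, I ^ i / I ^ (i + 1)` of a two-sided ideal `I`; it is an
`F`-algebra when `A` is one. -/
abbrev Gr : Type _ := DirectSum ℕ (GrPiece I)

end Graded

/-! ### Completed group algebras of congruence subgroups -/

section GroupAlgebra

variable (k : Type*) [Field k] {G : Type*} [Group G]

/-- The augmentation ideal `ω(G)` of `k[G]`: the kernel of the `k`-algebra homomorphism
`k[G] → k` that sends every `g` to `1`. -/
def augmentationIdeal (G : Type*) [Group G] : Ideal (MonoidAlgebra k G) :=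
  RingHom.ker (MonoidAlgebra.lift k k G (1 : G →* k))

instance : (augmentationIdeal k G).IsTwoSided := inferInstanceAs (RingHom.ker _).IsTwoSided

/-- For a normal subgroup `N` of `G`, the ideal `ω(N) k[G]` of `k[G]`, that is, the kernel of
`k[G] → k[G ⧸ N]`; see `relativeAugmentationIdeal_eq_span` for its generators. -/
def relativeAugmentationIdeal (N : Subgroup G) [N.Normal] : Ideal (MonoidAlgebra k G) :=
  RingHom.ker (MonoidAlgebra.mapDomainRingHom k (QuotientGroup.mk' N))

instance (N : Subgroup G) [N.Normal] : (relativeAugmentationIdeal k N).IsTwoSided :=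
  inferInstanceAs (RingHom.ker _).IsTwoSided

theorem relativeAugmentationIdeal_eq_span (N : Subgroup G) [N.Normal] :
    relativeAugmentationIdeal k N =
      Ideal.span {x | ∃ g ∈ N, x = MonoidAlgebra.of k G g - 1} := by
  set J : Ideal (MonoidAlgebra k G) :=
    Ideal.span {x | ∃ g ∈ N, x = MonoidAlgebra.of k G g - 1} with hJ
  have key : ∀ x : MonoidAlgebra k G,
      x - MonoidAlgebra.mapDomain (Quotient.out : G ⧸ N → G)
        (MonoidAlgebra.mapDomainRingHom k (QuotientGroup.mk' N) x) ∈ J := by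
    intro x
    induction x using MonoidAlgebra.induction_linear with
    | zero => simp
    | add a b ha hb =>
      rw [map_add, MonoidAlgebra.mapDomain_add, add_sub_add_comm]
      exact J.add_mem ha hb
    | single g c =>
      obtain ⟨h, hh⟩ := QuotientGroup.mk_out_eq_mul N g
      have h1 : MonoidAlgebra.of k G (h : G) - 1 ∈ J := Ideal.subset_span ⟨h, h.2, rfl⟩
      have h2 := J.neg_mem (J.mul_mem_left (MonoidAlgebra.single g c) h1)
      rw [mul_sub, mul_one, neg_sub, MonoidAlgebra.of_apply, MonoidAlgebra.single_mul_single,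
        mul_one, ← hh] at h2
      simpa using h2
  apply le_antisymm
  · intro x hx
    have h1 := key x
    rw [relativeAugmentationIdeal, RingHom.mem_ker] at hx
    rw [hx] at h1
    simpa using h1
  · refine Ideal.span_le.2 ?_
    rintro _ ⟨g, hg, rfl⟩
    have h1 : (QuotientGroup.mk' N) g = 1 := (QuotientGroup.eq_one_iff g).2 hg
    change MonoidAlgebra.mapDomainRingHom k (QuotientGroup.mk' N) _ = 0
    rw [map_sub, map_one, MonoidAlgebra.of_apply, MonoidAlgebra.mapDomainRingHom_apply,
      MonoidAlgebra.mapDomain_single, h1, MonoidAlgebra.one_def, sub_self]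

theorem relativeAugmentationIdeal_mono {M N : Subgroup G} [M.Normal] [N.Normal] (h : M ≤ N) :
    relativeAugmentationIdeal k M ≤ relativeAugmentationIdeal k N := by
  rw [relativeAugmentationIdeal_eq_span, relativeAugmentationIdeal_eq_span]
  exact Ideal.span_mono fun x ⟨g, hg, hx⟩ => ⟨g, h hg, hx⟩

variable (p d u : ℕ) [Fact p.Prime]

/-- The ideals `ω(Γ_n) k[Γ]` of `k[Γ]`, where `Γ` is the congruence subgroup of level `p ^ u` and
`Γ_n ≤ Γ` is the one of level `p ^ (u + n)`, for `n = 0, 1, 2, …`. -/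
def congruenceIdeal (n : ℕ) : Ideal (MonoidAlgebra k (congruenceSubgroup p d u)) :=
  relativeAugmentationIdeal k
    ((congruenceSubgroup p d (u + n)).subgroupOf (congruenceSubgroup p d u))

instance (n : ℕ) : (congruenceIdeal k p d u n).IsTwoSided :=
  inferInstanceAs (relativeAugmentationIdeal _ _).IsTwoSided

theorem congruenceIdeal_antitone : Antitone (congruenceIdeal k p d u) := fun _ _ h =>
  relativeAugmentationIdeal_mono k
    (Subgroup.comap_mono (congruenceSubgroup_antitone p d (Nat.add_le_add_left h u)))

/-- The completed group algebra `k[[Γ]] = lim k[Γ] / ω(Γ_n) k[Γ] = lim k[Γ / Γ_n]` of the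
congruence subgroup `Γ` of level `p ^ u`. -/
abbrev CompletedGroupAlgebra : Type _ :=
  Completion k (congruenceIdeal k p d u) (congruenceIdeal_antitone k p d u)

/-- The closure in `k[[Γ]]` of the augmentation ideal of `k[Γ]`. -/
abbrev closedAugmentationIdeal : Ideal (CompletedGroupAlgebra k p d u) :=
  Completion.idealClosure k (congruenceIdeal k p d u) (congruenceIdeal_antitone k p d u)
    (augmentationIdeal k (congruenceSubgroup p d u))

end GroupAlgebra

end

/-! Writing g = 1 + p^u A identifies Γ, as a set, with the abelian group M = ℤ_p^(d×d); the product
becomes A ∘ B = A + B + p^u AB. Cosets of Γ(u+n) become cosets of p^n M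
(`inv_mul_mem_subgroupOf_iff`), so as a topological vector space k[[Γ]] is the completed group
algebra of M. The character θ(a) = ∏ (1 + X_s)^(a_s) turns the latter into the power series ring in
d² variables; call the resulting linear bijection Ψ.

The two multiplications agree to leading order. Indeed θ(A ∘ B) = θ(A) θ(B) θ(AB)^(p^u), and in
characteristic p the series θ(AB)^(p^u) - 1 has order at least p^u ≥ 3. To pass from group elements
to elements of orders i and j, approximate these by combinations of i-fold and j-fold products of
differences h - 1. What counts is then the growth of order under iterated differences of the
correction factor. Since AB is bilinear, A ↦ θ(AB)^(p^u) is a character, and each difference after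
the first gains one order. The result is Ψ(xy) ≡ Ψ(x)Ψ(y) modulo order i + j + 1
(`linearExtend_twisted_mem`, `groupAlgebraToPowerSeries_mul_sub_mem`).

The rest is formal for any algebra with such a Ψ (`IsFilteredMul`). Leading forms multiply as
polynomials, which excludes zero divisors. Relations between leading forms lift by successive
approximation (`exists_eq_sum_mul`), which gives the noetherian property and shows that the n-th
power of the closed augmentation ideal consists of all elements of order at least n. Hence the
graded ring is the polynomial ring. -/

noncomputable section

/-! ### The order filtration on power series -/

namespace MvPowerSeries

variable {σ k : Type*}

section OrderIdeal

variable [CommRing k]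

variable (σ k) in
/-- The ideal of power series of order at least `n`. -/
def orderIdeal (n : ℕ) : Ideal (MvPowerSeries σ k) where
  carrier := {f | (n : ℕ∞) ≤ f.order}
  zero_mem' := by simp
  add_mem' ha hb := (le_min ha hb).trans min_order_le_add
  smul_mem' c x hx := by
    rw [smul_eq_mul]
    exact (le_add_left hx).trans le_order_mul

theorem mem_orderIdeal {n : ℕ} {f : MvPowerSeries σ k} :
    f ∈ orderIdeal σ k n ↔ (n : ℕ∞) ≤ f.order := Iff.rfl

theorem mem_orderIdeal_iff_coeff {n : ℕ} {f : MvPowerSeries σ k} :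
    f ∈ orderIdeal σ k n ↔ ∀ α : σ →₀ ℕ, α.degree < n → coeff α f = 0 :=
  ⟨fun h _ hα => coeff_of_lt_order ((Nat.cast_lt.2 hα).trans_le h), fun h => nat_le_order h⟩

theorem orderIdeal_antitone : Antitone (orderIdeal σ k) := fun _ _ h _ hf =>
  mem_orderIdeal.2 ((Nat.cast_le.2 h).trans (mem_orderIdeal.1 hf))

theorem mem_orderIdeal_zero (f : MvPowerSeries σ k) : f ∈ orderIdeal σ k 0 := by
  simp [mem_orderIdeal]

theorem mul_mem_orderIdeal {m n : ℕ} {f g : MvPowerSeries σ k} (hf : f ∈ orderIdeal σ k m)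
    (hg : g ∈ orderIdeal σ k n) : f * g ∈ orderIdeal σ k (m + n) := by
  rw [mem_orderIdeal, Nat.cast_add]
  exact (add_le_add hf hg).trans le_order_mul

theorem pow_mem_orderIdeal {f : MvPowerSeries σ k} (hf : f ∈ orderIdeal σ k 1) (n : ℕ) :
    f ^ n ∈ orderIdeal σ k n := by
  induction n with
  | zero => exact mem_orderIdeal_zero _
  | succ n ih => rw [pow_succ]; exact mul_mem_orderIdeal ih hf

theorem smul_mem_orderIdeal {n : ℕ} {f : MvPowerSeries σ k} (c : k) (hf : f ∈ orderIdeal σ k n) :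
    c • f ∈ orderIdeal σ k n := Submodule.smul_of_tower_mem _ c hf

theorem eq_zero_of_forall_mem_orderIdeal {f : MvPowerSeries σ k}
    (h : ∀ n, f ∈ orderIdeal σ k n) : f = 0 := by
  ext α
  exact mem_orderIdeal_iff_coeff.1 (h (α.degree + 1)) α (Nat.lt_succ_self _)

theorem mem_orderIdeal_one_iff {f : MvPowerSeries σ k} :
    f ∈ orderIdeal σ k 1 ↔ constantCoeff f = 0 := by
  rw [mem_orderIdeal, Nat.cast_one, one_le_order_iff_constCoeff_eq_zero]

theorem X_mem_orderIdeal (s : σ) : (X s : MvPowerSeries σ k) ∈ orderIdeal σ k 1 := by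
  rw [mem_orderIdeal_one_iff, constantCoeff_X]

/-- A series whose `m`-th term has order at least `m - c` converges. -/
theorem exists_sum_sub_mem_orderIdeal (f : ℕ → MvPowerSeries σ k) (b c : ℕ)
    (hf : ∀ m, f m ∈ orderIdeal σ k (b + m - c)) :
    ∃ s, ∀ m, s - ∑ i ∈ Finset.range m, f i ∈ orderIdeal σ k (b + m - c) := by
  -- Terms with index above |α| + c have order greater than |α|, so each coefficient of the limit is
  -- a finite sum.
  let s : MvPowerSeries σ k := fun α => ∑ i ∈ Finset.range (α.degree + c + 1), coeff α (f i)
  refine ⟨s, fun m => ?_⟩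
  rw [mem_orderIdeal_iff_coeff]
  intro α hα
  rw [map_sub, map_sum, sub_eq_zero]
  change ∑ i ∈ Finset.range (α.degree + c + 1), coeff α (f i) = _
  have hz : ∀ i, α.degree < b + i - c → coeff α (f i) = 0 := fun i hi =>
    mem_orderIdeal_iff_coeff.1 (hf i) α hi
  rcases le_total m (α.degree + c + 1) with h | h
  · refine (Finset.sum_subset (Finset.range_mono h) fun i _ hi => hz i ?_).symm
    simp only [Finset.mem_range, not_lt] at hi
    omega
  · refine Finset.sum_subset (Finset.range_mono h) fun i _ hi => hz i ?_
    simp only [Finset.mem_range, not_lt] at hi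
    omega

end OrderIdeal

/-! ### Leading forms of power series -/

section Lead

variable [Field k] [Finite σ]

/-- The homogeneous component of degree `n` of a power series, as a polynomial. -/
def lead (n : ℕ) : MvPowerSeries σ k →ₗ[k] MvPolynomial σ k :=
  truncFinset k (Finsupp.finite_of_degree_eq n).toFinset

theorem coeff_lead (n : ℕ) (f : MvPowerSeries σ k) (α : σ →₀ ℕ) :
    (lead n f).coeff α = if α.degree = n then coeff α f else 0 := by
  classical
  rw [lead, coeff_truncFinset]
  simp

theorem coe_lead (n : ℕ) (f : MvPowerSeries σ k) :
    (lead n f : MvPowerSeries σ k) = homogeneousComponent n f := by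
  ext α
  rw [MvPolynomial.coeff_coe, coeff_lead, coeff_homogeneousComponent]

theorem lead_isHomogeneous (n : ℕ) (f : MvPowerSeries σ k) : (lead n f).IsHomogeneous n := by
  intro α hα
  rw [coeff_lead] at hα
  rw [show (1 : σ → ℕ) = fun _ => 1 from rfl, ← Finsupp.degree_eq_weight_one]
  by_contra h
  exact hα (if_neg h)

theorem lead_mul {m n : ℕ} {f g : MvPowerSeries σ k} (hf : f ∈ orderIdeal σ k m)
    (hg : g ∈ orderIdeal σ k n) : lead (m + n) (f * g) = lead m f * lead n g := by
  apply MvPolynomial.coe_injective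
  rw [MvPolynomial.coe_mul, coe_lead, coe_lead, coe_lead,
    homogeneousComponent_mul_of_le_order hf hg]

theorem lead_coe (n : ℕ) (q : MvPolynomial σ k) :
    lead n (q : MvPowerSeries σ k) = MvPolynomial.homogeneousComponent n q := by
  ext α
  rw [coeff_lead, MvPolynomial.coeff_homogeneousComponent, MvPolynomial.coeff_coe]

theorem lead_eq_zero_iff {n : ℕ} {f : MvPowerSeries σ k} (hf : f ∈ orderIdeal σ k n) :
    lead n f = 0 ↔ f ∈ orderIdeal σ k (n + 1) := by
  rw [mem_orderIdeal_iff_coeff] at hf ⊢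
  constructor
  · intro h α hα
    rcases Nat.lt_succ_iff_lt_or_eq.1 hα with h1 | h1
    · exact hf α h1
    · have := coeff_lead n f α
      rw [h, if_pos h1, MvPolynomial.coeff_zero] at this
      exact this.symm
  · intro h
    ext α
    rw [coeff_lead, MvPolynomial.coeff_zero]
    split_ifs with h1
    · exact h α (by omega)
    · rfl

omit [Finite σ] in
theorem coe_mem_orderIdeal_of_isHomogeneous {n : ℕ} {q : MvPolynomial σ k}
    (hq : q.IsHomogeneous n) : (q : MvPowerSeries σ k) ∈ orderIdeal σ k n := by
  rw [mem_orderIdeal_iff_coeff]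
  intro α hα
  rw [MvPolynomial.coeff_coe]
  exact hq.coeff_eq_zero hα.ne

omit [Finite σ] in
theorem _root_.MvPolynomial.homogeneousComponent_mul_of_isHomogeneous {m n : ℕ}
    (c : MvPolynomial σ k) {q : MvPolynomial σ k} (hq : q.IsHomogeneous m) :
    MvPolynomial.homogeneousComponent n (c * q) =
      if m ≤ n then MvPolynomial.homogeneousComponent (n - m) c * q else 0 := by
  induction c using MvPolynomial.induction_on' with
  | monomial α r =>
    rw [MvPolynomial.homogeneousComponent_of_mem
      ((MvPolynomial.isHomogeneous_monomial r rfl).mul hq),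
      MvPolynomial.homogeneousComponent_of_mem (MvPolynomial.isHomogeneous_monomial r rfl)]
    split_ifs <;> first | omega | simp
  | add f g hf hg =>
    rw [add_mul, map_add, map_add, hf, hg]
    split_ifs <;> simp [add_mul]

theorem lead_mem_span_X {n : ℕ} (hn : 0 < n) (f : MvPowerSeries σ k) :
    lead n f ∈ Ideal.span (Set.range (MvPolynomial.X : σ → MvPolynomial σ k)) := by
  change _ ∈ MvPolynomial.idealOfVars σ k
  rw [← pow_one (MvPolynomial.idealOfVars σ k), MvPolynomial.mem_pow_idealOfVars_iff]
  intro α hα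
  rw [MvPolynomial.mem_support_iff, coeff_lead] at hα
  by_contra h
  exact hα (if_neg (by omega))

end Lead

end MvPowerSeries

/-! ### Algebras with a filtered identification with a power series ring -/

open MvPowerSeries

section Filtered

variable {σ k A : Type*} [Field k] [Finite σ] [Ring A] [Algebra k A]

/-- The linear bijection `Ψ` onto a power series ring is multiplicative up to terms of higher
order. -/
def IsFilteredMul (Ψ : A ≃ₗ[k] MvPowerSeries σ k) : Prop :=
  ∀ (i j : ℕ) (x y : A), Ψ x ∈ orderIdeal σ k i → Ψ y ∈ orderIdeal σ k j →
    Ψ (x * y) - Ψ x * Ψ y ∈ orderIdeal σ k (i + j + 1)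

namespace IsFilteredMul

variable {Ψ : A ≃ₗ[k] MvPowerSeries σ k} (hΨ : IsFilteredMul Ψ)
include hΨ

omit [Finite σ] in
theorem mul_mem {i j : ℕ} {x y : A} (hx : Ψ x ∈ orderIdeal σ k i) (hy : Ψ y ∈ orderIdeal σ k j) :
    Ψ (x * y) ∈ orderIdeal σ k (i + j) := by
  rw [← sub_add_cancel (Ψ (x * y)) (Ψ x * Ψ y)]
  exact Ideal.add_mem _ (orderIdeal_antitone (Nat.le_succ _) (hΨ i j x y hx hy))
    (mul_mem_orderIdeal hx hy)

theorem lead_mul {i j : ℕ} {x y : A} (hx : Ψ x ∈ orderIdeal σ k i)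
    (hy : Ψ y ∈ orderIdeal σ k j) : lead (i + j) (Ψ (x * y)) = lead i (Ψ x) * lead j (Ψ y) := by
  rw [← MvPowerSeries.lead_mul hx hy, ← sub_eq_zero, ← map_sub, lead_eq_zero_iff]
  · exact hΨ i j x y hx hy
  · exact orderIdeal_antitone (Nat.le_succ _) (hΨ i j x y hx hy)

-- Commutativity of the power series ring makes the condition left-right symmetric, so left-handed
-- results transfer to the opposite ring.
omit [Finite σ] in
theorem op : IsFilteredMul ((MulOpposite.opLinearEquiv k).symm.trans Ψ : Aᵐᵒᵖ ≃ₗ[k] _) := by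
  intro i j x y hx hy
  have h := hΨ j i y.unop x.unop hy hx
  rw [mul_comm (Ψ y.unop), add_comm j i] at h
  exact h

-- Orders of power series over a field add, so `Ψ x * Ψ y` has order exactly i + j and cannot be
-- cancelled by an error of order i + j + 1.
omit [Finite σ] in
theorem isDomain : IsDomain A := by
  have : Nontrivial A := Ψ.toEquiv.nontrivial
  have : NoZeroDivisors A := by
    constructor
    intro x y hxy
    by_contra! hne
    obtain ⟨hx, hy⟩ := hne
    have hx' : Ψ x ≠ 0 := by simpa using hx
    have hy' : Ψ y ≠ 0 := by simpa using hy
    have hx'' := ne_zero_iff_order_finite.1 hx'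
    have hy'' := ne_zero_iff_order_finite.1 hy'
    have h := hΨ (Ψ x).order.toNat (Ψ y).order.toNat x y hx''.le hy''.le
    rw [hxy, map_zero, zero_sub, neg_mem_iff, mem_orderIdeal, order_mul, Nat.cast_succ,
      Nat.cast_add, hx'', hy'', ← hx'', ← hy''] at h
    exact absurd (by exact_mod_cast h) (Nat.not_succ_le_self _)
  exact NoZeroDivisors.to_isDomain A

/-! ### Lifting relations between leading forms -/

section Approx

variable {ι : Type*} [Fintype ι] (g : ι → A) (δ : ι → ℕ)
  (hg : ∀ t, Ψ (g t) ∈ orderIdeal σ k (δ t))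
include hg

theorem exists_approx_step {n : ℕ} {x : A} (hx : Ψ x ∈ orderIdeal σ k n)
    (h : lead n (Ψ x) ∈ Ideal.span (Set.range fun t => lead (δ t) (Ψ (g t)))) :
    ∃ a : ι → A, (∀ t, Ψ (a t) ∈ orderIdeal σ k (n - δ t)) ∧
      Ψ (x - ∑ t, a t * g t) ∈ orderIdeal σ k (n + 1) := by
  obtain ⟨c, hc⟩ := (Ideal.mem_span_range_iff_exists_fun).1 h
  -- Only the part of `c t` of degree n - δ t matters in degree n; a generator with δ t > n
  -- contributes nothing there.
  let a : ι → A := fun t => if δ t ≤ n then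
    Ψ.symm (MvPolynomial.homogeneousComponent (n - δ t) (c t) : MvPolynomial σ k) else 0
  have ha : ∀ t, Ψ (a t) ∈ orderIdeal σ k (n - δ t) := by
    intro t
    by_cases ht : δ t ≤ n
    · simp only [a, if_pos ht, LinearEquiv.apply_symm_apply]
      exact coe_mem_orderIdeal_of_isHomogeneous
        (MvPolynomial.homogeneousComponent_isHomogeneous _ _)
    · simp [a, if_neg ht]
  have hag : ∀ t, Ψ (a t * g t) ∈ orderIdeal σ k n ∧ lead n (Ψ (a t * g t)) =
      MvPolynomial.homogeneousComponent n (c t * lead (δ t) (Ψ (g t))) := by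
    intro t
    by_cases ht : δ t ≤ n
    · have h1 := hΨ.mul_mem (ha t) (hg t)
      have h2 := hΨ.lead_mul (ha t) (hg t)
      rw [Nat.sub_add_cancel ht] at h1 h2
      refine ⟨h1, ?_⟩
      rw [h2]
      simp only [a, if_pos ht, LinearEquiv.apply_symm_apply, lead_coe]
      rw [MvPolynomial.homogeneousComponent_of_mem
        (MvPolynomial.homogeneousComponent_isHomogeneous _ _), if_pos rfl,
        MvPolynomial.homogeneousComponent_mul_of_isHomogeneous _ (lead_isHomogeneous _ _),
        if_pos ht]
    · rw [MvPolynomial.homogeneousComponent_mul_of_isHomogeneous _ (lead_isHomogeneous _ _),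
        if_neg ht]
      simp [a, if_neg ht]
  refine ⟨a, ha, ?_⟩
  have hmem : Ψ (x - ∑ t, a t * g t) ∈ orderIdeal σ k n := by
    rw [map_sub, map_sum]
    exact Ideal.sub_mem _ hx (Ideal.sum_mem _ fun t _ => (hag t).1)
  rw [← lead_eq_zero_iff hmem, map_sub, map_sub, map_sum, map_sum,
    Finset.sum_congr rfl fun t _ => (hag t).2, ← map_sum, hc,
    MvPolynomial.homogeneousComponent_of_mem (lead_isHomogeneous n _), if_pos rfl, sub_self]

/-- Successive approximation: if the leading forms of the elements of `C` are combinations of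
those of the `g t`, then the elements of `C` are combinations of the `g t`. -/
theorem exists_eq_sum_mul (C : AddSubgroup A) (hC : ∀ a t, a * g t ∈ C) (b : ℕ)
    (h : ∀ n, b ≤ n → ∀ x ∈ C, Ψ x ∈ orderIdeal σ k n →
      lead n (Ψ x) ∈ Ideal.span (Set.range fun t => lead (δ t) (Ψ (g t))))
    {x : A} (hx : x ∈ C) (hxb : Ψ x ∈ orderIdeal σ k b) :
    ∃ a : ι → A, (∀ t, Ψ (a t) ∈ orderIdeal σ k (b - δ t)) ∧ x = ∑ t, a t * g t := by
  have step : ∀ (n : ℕ) (y : {y : A // y ∈ C ∧ Ψ y ∈ orderIdeal σ k (b + n)}),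
      ∃ a : ι → A, (∀ t, Ψ (a t) ∈ orderIdeal σ k (b + n - δ t)) ∧
        Ψ (y.1 - ∑ t, a t * g t) ∈ orderIdeal σ k (b + n + 1) := fun n y =>
    hΨ.exists_approx_step g δ hg y.2.2 (h _ (Nat.le_add_right _ _) _ y.2.1 y.2.2)
  choose a ha ha' using step
  -- The successive remainders, starting from x. They stay in `C`, so the hypothesis on leading
  -- forms applies at every stage.
  let y : ∀ n : ℕ, {y : A // y ∈ C ∧ Ψ y ∈ orderIdeal σ k (b + n)} := fun n =>
    Nat.rec ⟨x, hx, hxb⟩ (fun n y => ⟨y.1 - ∑ t, a n y t * g t,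
      C.sub_mem y.2.1 (C.sum_mem fun t _ => hC _ t), ha' n y⟩) n
  have hy : ∀ n, x = (y n).1 + ∑ t, (∑ i ∈ Finset.range n, a i (y i) t) * g t := by
    intro n
    induction n with
    | zero => simp [y]
    | succ n ih =>
      have : (y (n + 1)).1 = (y n).1 - ∑ t, a n (y n) t * g t := rfl
      rw [this]
      simp only [Finset.sum_range_succ, add_mul, Finset.sum_add_distrib]
      rw [ih]
      simp only [Finset.sum_mul]
      abel
  -- The corrections to each coefficient have order tending to infinity, hence a convergent sum.
  have hlim : ∀ t, ∃ s, ∀ m, s - ∑ i ∈ Finset.range m, Ψ (a i (y i) t) ∈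
      orderIdeal σ k (b + m - δ t) := fun t =>
    exists_sum_sub_mem_orderIdeal _ _ _ fun m => ha m (y m) t
  choose s hs using hlim
  refine ⟨fun t => Ψ.symm (s t), fun t => by simpa using hs t 0, ?_⟩
  rw [← sub_eq_zero, ← Ψ.map_eq_zero_iff]
  refine eq_zero_of_forall_mem_orderIdeal fun n => orderIdeal_antitone (Nat.le_add_left n b) ?_
  have h1 : x - ∑ t, Ψ.symm (s t) * g t = (y n).1 -
      ∑ t, (Ψ.symm (s t) - ∑ i ∈ Finset.range n, a i (y i) t) * g t := by
    conv_lhs => rw [hy n]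
    simp only [sub_mul, Finset.sum_sub_distrib]
    abel
  rw [h1, map_sub, map_sum]
  refine Ideal.sub_mem _ (y n).2.2 (Ideal.sum_mem _ fun t _ => ?_)
  refine orderIdeal_antitone (by omega) (hΨ.mul_mem (i := b + n - δ t) ?_ (hg t))
  rw [map_sub, map_sum, LinearEquiv.apply_symm_apply]
  exact hs t n

end Approx

/-- By Hilbert's basis theorem the leading forms of a left ideal span a finitely generated ideal of
polynomials; elements of the left ideal realizing a finite generating set generate it by successive
approximation. -/
theorem isNoetherianRing : IsNoetherianRing A := by
  classical
  rw [isNoetherianRing_iff_ideal_fg]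
  intro I
  let S : Set (MvPolynomial σ k) :=
    {q | ∃ n, ∃ x ∈ I, Ψ x ∈ orderIdeal σ k n ∧ lead n (Ψ x) = q}
  obtain ⟨T, hTS, hT⟩ := (Submodule.fg_span_iff_fg_span_finset_subset S).1
    (IsNoetherian.noetherian (Ideal.span S))
  choose δ g hgI hg hgT using fun t : T => hTS t.2
  refine ⟨Finset.univ.image g, le_antisymm ?_ ?_⟩
  · rw [Submodule.span_le]
    intro x hx
    obtain ⟨t, -, rfl⟩ := Finset.mem_image.1 (Finset.mem_coe.1 hx)
    exact hgI t
  · intro x hx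
    obtain ⟨a, -, rfl⟩ := hΨ.exists_eq_sum_mul g δ hg I.toAddSubgroup
      (fun a t => I.mul_mem_left a (hgI t)) 0 (fun n _ x hx hxn => by
        have h1 : lead n (Ψ x) ∈ Submodule.span (MvPolynomial σ k) S :=
          Submodule.subset_span ⟨n, x, hx, hxn, rfl⟩
        rw [hT] at h1
        convert h1
        simp [hgT]) hx (mem_orderIdeal_zero _)
    exact Submodule.sum_mem _ fun t _ =>
      Submodule.smul_mem _ _ (Submodule.subset_span (by simp))

/-! ### Powers of the ideal of order one and the associated graded ring -/

variable {I : Ideal A} (hI : ∀ x, x ∈ I ↔ Ψ x ∈ orderIdeal σ k 1)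
include hI

/-- A form of positive degree lies in the ideal of the variables, so an element of order n + 1 is a
finite sum of terms a_s · `Ψ.symm (X s)` with a_s of order n. No closure of the power is therefore
needed. -/
theorem mem_pow_iff (n : ℕ) (x : A) : x ∈ I ^ n ↔ Ψ x ∈ orderIdeal σ k n := by
  induction n generalizing x with
  | zero => simp [mem_orderIdeal_zero, Submodule.pow_zero, Ideal.one_eq_top]
  | succ n ih =>
    constructor
    · intro hx
      rw [Submodule.pow_succ] at hx
      refine Submodule.mul_induction_on hx (fun a ha b hb => ?_) fun a b ha hb => ?_
      · exact hΨ.mul_mem ((ih a).1 ha) ((hI b).1 hb)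
      · rw [map_add]; exact Ideal.add_mem _ ha hb
    · intro hx
      have := Fintype.ofFinite σ
      obtain ⟨a, ha, rfl⟩ := hΨ.exists_eq_sum_mul (fun s : σ => Ψ.symm (X s)) (fun _ => 1)
        (fun s => by simpa using X_mem_orderIdeal s) ⊤ (fun _ _ => trivial) (n + 1)
        (fun m hm x _ _ => by
          convert lead_mem_span_X (n := m) (by omega) (Ψ x) using 4 with s
          rw [LinearEquiv.apply_symm_apply, ← MvPolynomial.coe_X, lead_coe,
            MvPolynomial.homogeneousComponent_of_mem (MvPolynomial.isHomogeneous_X k s),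
            if_pos rfl]) (x := x) trivial hx
      rw [Submodule.pow_succ]
      refine Ideal.sum_mem _ fun s _ => Ideal.mul_mem_mul ((ih _).2 (ha s)) ((hI _).2 ?_)
      simpa using X_mem_orderIdeal s

theorem eq_zero_of_forall_mem_pow {x : A} (hx : ∀ n : ℕ, x ∈ I ^ n) : x = 0 :=
  Ψ.map_eq_zero_iff.1 <| eq_zero_of_forall_mem_orderIdeal fun n => (hΨ.mem_pow_iff hI n x).1 (hx n)

/-- The leading form of a class in `I ^ i / I ^ (i + 1)`. -/
def grLead (i : ℕ) : GrPiece I i →ₗ[k] MvPolynomial σ k where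
  toFun x := Quotient.liftOn' x (fun a => lead i (Ψ a.1)) (by
    intro a b h
    have h1 := (GrPiece.mk_eq_iff I a.2 b.2).1 (Quotient.sound' h)
    rw [← sub_eq_zero, ← map_sub, ← map_sub, lead_eq_zero_iff]
    · exact (hΨ.mem_pow_iff hI _ _).1 h1
    · exact (hΨ.mem_pow_iff hI _ _).1 (Ideal.sub_mem _ a.2 b.2))
  map_add' x y := by
    obtain ⟨a, ha, rfl⟩ := GrPiece.exists_mk I x
    obtain ⟨b, hb, rfl⟩ := GrPiece.exists_mk I y
    change lead i (Ψ (a + b)) = lead i (Ψ a) + lead i (Ψ b)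
    rw [map_add, map_add]
  map_smul' c x := by
    obtain ⟨a, ha, rfl⟩ := GrPiece.exists_mk I x
    change lead i (Ψ (c • a)) = c • lead i (Ψ a)
    rw [map_smul, map_smul]

theorem grLead_mk {i : ℕ} (a : A) (ha : a ∈ I ^ i) :
    hΨ.grLead hI i (GrPiece.mk I i a ha) = lead i (Ψ a) := rfl

theorem grLead_isHomogeneous {i : ℕ} (x : GrPiece I i) : (hΨ.grLead hI i x).IsHomogeneous i := by
  obtain ⟨a, ha, rfl⟩ := GrPiece.exists_mk I x
  exact lead_isHomogeneous _ _

theorem grLead_injective (i : ℕ) : Function.Injective (hΨ.grLead hI i) := by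
  rw [injective_iff_map_eq_zero]
  intro x hx
  obtain ⟨a, ha, rfl⟩ := GrPiece.exists_mk I x
  rw [grLead_mk, lead_eq_zero_iff ((hΨ.mem_pow_iff hI _ _).1 ha)] at hx
  have h0 : (0 : GrPiece I i) = GrPiece.mk I i 0 (Ideal.zero_mem _) := rfl
  rw [h0, GrPiece.mk_eq_iff, sub_zero]
  exact (hΨ.mem_pow_iff hI _ _).2 hx

theorem exists_grLead_eq {i : ℕ} {q : MvPolynomial σ k} (hq : q.IsHomogeneous i) :
    ∃ x, hΨ.grLead hI i x = q := by
  refine ⟨GrPiece.mk I i (Ψ.symm q) ((hΨ.mem_pow_iff hI _ _).2 ?_), ?_⟩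
  · rw [LinearEquiv.apply_symm_apply]
    exact coe_mem_orderIdeal_of_isHomogeneous hq
  · rw [grLead_mk, LinearEquiv.apply_symm_apply, lead_coe,
      MvPolynomial.homogeneousComponent_of_mem hq, if_pos rfl]

theorem exists_algEquiv_gr (hΨ1 : Ψ 1 = 1) [I.IsTwoSided] :
    ∃ φ : Gr I ≃ₐ[k] MvPolynomial σ k, ∀ (i : ℕ) (x : GrPiece I i),
      (φ (DirectSum.of (GrPiece I) i x)).IsHomogeneous i := by
  let f : Gr I →ₐ[k] MvPolynomial σ k := DirectSum.toAlgebra k (GrPiece I) (hΨ.grLead hI)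
    (by
      change lead 0 (Ψ 1) = 1
      rw [hΨ1, ← MvPolynomial.coe_one, lead_coe,
        MvPolynomial.homogeneousComponent_of_mem (MvPolynomial.isHomogeneous_one _ _), if_pos rfl])
    (by
      intro i j x y
      obtain ⟨a, ha, rfl⟩ := GrPiece.exists_mk I x
      obtain ⟨b, hb, rfl⟩ := GrPiece.exists_mk I y
      exact hΨ.lead_mul ((hΨ.mem_pow_iff hI _ _).1 ha) ((hΨ.mem_pow_iff hI _ _).1 hb))
  have hf : ∀ (i : ℕ) (x : GrPiece I i),
      f (DirectSum.of (GrPiece I) i x) = hΨ.grLead hI i x := fun i x =>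
    DirectSum.toAddMonoid_of _ i x
  -- Homogeneous components separate the degrees, so injectivity of `f` reduces to that of each
  -- `grLead`.
  have hcomp : ∀ (i : ℕ) (x : Gr I),
      MvPolynomial.homogeneousComponent i (f x) = hΨ.grLead hI i (x i) := by
    intro i x
    induction x using DirectSum.induction_on with
    | zero => simp
    | of j x =>
      rw [hf, MvPolynomial.homogeneousComponent_of_mem (hΨ.grLead_isHomogeneous hI x)]
      by_cases h : i = j
      · subst h
        rw [if_pos rfl, DirectSum.of_eq_same]
      · rw [if_neg h, DirectSum.of_eq_of_ne _ _ _ h, map_zero]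
    | add x y hx hy => rw [map_add, map_add, hx, hy, DirectSum.add_apply, map_add]
  refine ⟨AlgEquiv.ofBijective f ⟨?_, ?_⟩, fun i x => ?_⟩
  · rw [injective_iff_map_eq_zero]
    intro x hx
    refine DFinsupp.ext fun i => hΨ.grLead_injective hI i ?_
    rw [← hcomp, hx]
    simp
  · intro q
    choose x hx using fun i => hΨ.exists_grLead_eq hI
      (MvPolynomial.homogeneousComponent_isHomogeneous i q)
    refine ⟨∑ i ∈ Finset.range (q.totalDegree + 1), DirectSum.of (GrPiece I) i (x i), ?_⟩
    rw [map_sum]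
    simp_rw [hf, hx]
    exact MvPolynomial.sum_homogeneousComponent q
  · change (f _).IsHomogeneous i
    rw [hf]
    exact hΨ.grLead_isHomogeneous hI x

end IsFilteredMul

end Filtered

/-! ### Functions whose iterated differences have growing order -/

section Differences

variable {σ k M : Type*} [CommRing k] [CommMonoid M]

/-- The `i`-fold differences of `f`, for `i ≤ j`, have order at least `n + i`. -/
def DiffOrderGE : ℕ → ℕ → (M → MvPowerSeries σ k) → Prop
  | 0, n, f => ∀ x, f x ∈ orderIdeal σ k n
  | j + 1, n, f => (∀ x, f x ∈ orderIdeal σ k n) ∧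
      ∀ h, DiffOrderGE j (n + 1) fun x => f (x * h) - f x

namespace DiffOrderGE

variable {j n m : ℕ} {f g : M → MvPowerSeries σ k}

theorem congr (hf : DiffOrderGE j m f) (hmn : m = n) (h : ∀ x, g x = f x) : DiffOrderGE j n g := by
  rwa [← hmn, funext h]

theorem mono_order (hf : DiffOrderGE j n f) (h : m ≤ n) : DiffOrderGE j m f := by
  induction j generalizing f n m with
  | zero => exact fun x => orderIdeal_antitone h (hf x)
  | succ j ih =>
    exact ⟨fun x => orderIdeal_antitone h (hf.1 x), fun y => ih (hf.2 y) (Nat.succ_le_succ h)⟩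

theorem of_succ (hf : DiffOrderGE (j + 1) n f) : DiffOrderGE j n f := by
  induction j generalizing f n with
  | zero => exact hf.1
  | succ j ih => exact ⟨hf.1, fun h => ih (hf.2 h)⟩

theorem add (hf : DiffOrderGE j n f) (hg : DiffOrderGE j n g) :
    DiffOrderGE j n fun x => f x + g x := by
  induction j generalizing f g n with
  | zero => exact fun x => Ideal.add_mem _ (hf x) (hg x)
  | succ j ih =>
    refine ⟨fun x => Ideal.add_mem _ (hf.1 x) (hg.1 x), fun h => ?_⟩
    exact (ih (hf.2 h) (hg.2 h)).congr rfl fun x => by ring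

theorem zero : DiffOrderGE j n fun _ : M => (0 : MvPowerSeries σ k) := by
  induction j generalizing n with
  | zero => exact fun _ => Ideal.zero_mem _
  | succ j ih =>
    refine ⟨fun _ => Ideal.zero_mem _, fun h => ?_⟩
    simpa using ih

theorem const {c : MvPowerSeries σ k} (hc : c ∈ orderIdeal σ k n) :
    DiffOrderGE j n fun _ : M => c := by
  cases j with
  | zero => exact fun _ => hc
  | succ j => exact ⟨fun _ => hc, fun h => by simpa using zero⟩

/-- Leibniz rule: the difference of fg is Δf · (g + Δg) + f · Δg. -/
theorem mul (hf : DiffOrderGE j n f) (hg : DiffOrderGE j m g) :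
    DiffOrderGE j (n + m) fun x => f x * g x := by
  induction j generalizing f g n m with
  | zero => exact fun x => mul_mem_orderIdeal (hf x) (hg x)
  | succ j ih =>
    refine ⟨fun x => mul_mem_orderIdeal (hf.1 x) (hg.1 x), fun h => ?_⟩
    have h1 := ih (hf.2 h) (hg.of_succ.add ((hg.2 h).mono_order (Nat.le_succ m)))
    have h2 := ih hf.of_succ (hg.2 h)
    rw [Nat.succ_add_eq_add_succ] at h1
    exact (h1.add h2).congr (add_assoc n m 1).symm fun x => by ring

/-- The difference by h replaces c by c (χ h - 1), of order one higher, and keeps the shape c χ. -/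
theorem mul_monoidHom {c : MvPowerSeries σ k} (hc : c ∈ orderIdeal σ k n)
    (χ : M →* MvPowerSeries σ k) (hχ : ∀ x, χ x - 1 ∈ orderIdeal σ k 1) :
    DiffOrderGE j n fun x => c * χ x := by
  induction j generalizing c n with
  | zero => exact fun x => Ideal.mul_mem_right _ _ hc
  | succ j ih =>
    refine ⟨fun x => Ideal.mul_mem_right _ _ hc, fun h => ?_⟩
    exact (ih (mul_mem_orderIdeal hc (hχ h))).congr rfl fun x => by simp only [map_mul]; ring

/-- The first difference (χ h - 1) χ has the same guaranteed order as χ - 1 itself; only later ones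
gain. This costs one order: n + 1 is assumed and n obtained. -/
theorem monoidHom_sub_one (χ : M →* MvPowerSeries σ k) (hχ : ∀ x, χ x - 1 ∈ orderIdeal σ k (n + 1)) :
    DiffOrderGE j n fun x => χ x - 1 := by
  cases j with
  | zero => exact fun x => orderIdeal_antitone (Nat.le_succ n) (hχ x)
  | succ j =>
    refine ⟨fun x => orderIdeal_antitone (Nat.le_succ n) (hχ x), fun h => ?_⟩
    exact (mul_monoidHom (hχ h) χ fun x => orderIdeal_antitone (Nat.le_add_left 1 n)
      (hχ x)).congr rfl fun x => by simp only [map_mul]; ring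

end DiffOrderGE

end Differences

/-! ### The twisted product on the group algebra of an abelian group -/

section Twisted

variable {σ k M : Type*} [Field k] [CommMonoid M]

/-- The linear extension of a function on `M` to the monoid algebra. -/
def MonoidAlgebra.linearExtend {V : Type*} [AddCommMonoid V] [Module k V] (f : M → V) :
    MonoidAlgebra k M →ₗ[k] V :=
  Finsupp.linearCombination k f ∘ₗ (MonoidAlgebra.coeffLinearEquiv k).toLinearMap

omit [CommMonoid M] in
theorem MonoidAlgebra.linearExtend_single {V : Type*} [AddCommMonoid V] [Module k V] (f : M → V)
    (x : M) (c : k) : MonoidAlgebra.linearExtend f (MonoidAlgebra.single x c) = c • f x := by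
  simp [MonoidAlgebra.linearExtend]

variable (k M) in
/-- The ideal of a commutative monoid algebra generated by the elements `h - 1`. -/
def differenceIdeal : Ideal (MonoidAlgebra k M) :=
  Ideal.span (Set.range fun h : M => MonoidAlgebra.single h 1 - 1)

/-- Since I absorbs multipliers, generators suffice, although `R` is only a k-subspace: the maps to
be estimated are linear but not multiplicative. -/
theorem mul_differenceIdeal_induction {R : Submodule k (MonoidAlgebra k M)}
    {I : Ideal (MonoidAlgebra k M)}
    (h : ∀ r ∈ I, ∀ x : M, r * (MonoidAlgebra.single x 1 - 1) ∈ R) {s : MonoidAlgebra k M}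
    (hs : s ∈ I * differenceIdeal k M) : s ∈ R := by
  refine Submodule.mul_induction_on hs (fun r hr t ht => ?_) fun a b ha hb => R.add_mem ha hb
  induction ht using Submodule.span_induction generalizing r with
  | mem t ht =>
    obtain ⟨x, rfl⟩ := ht
    exact h r hr x
  | zero => rw [mul_zero]; exact R.zero_mem
  | add a b _ _ ha hb => rw [mul_add]; exact R.add_mem (ha r hr) (hb r hr)
  | smul a t _ ht =>
    rw [smul_eq_mul, ← mul_assoc]
    exact ht _ (Ideal.mul_mem_right _ _ hr)

/-- Evaluating the extension of f at r (h - 1) is evaluating the extension of the difference of f by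
h at r. -/
theorem linearExtend_mem_orderIdeal {i n : ℕ} {f : M → MvPowerSeries σ k}
    (hf : DiffOrderGE i n f) {r : MonoidAlgebra k M} (hr : r ∈ differenceIdeal k M ^ i) :
    MonoidAlgebra.linearExtend f r ∈ orderIdeal σ k (n + i) := by
  induction i generalizing f n r with
  | zero =>
    induction r using MonoidAlgebra.induction_linear with
    | zero => rw [map_zero]; exact Ideal.zero_mem _
    | add a b ha hb =>
      rw [map_add]
      exact Ideal.add_mem _ (ha (by simp)) (hb (by simp))
    | single x c =>
      rw [MonoidAlgebra.linearExtend_single]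
      exact smul_mem_orderIdeal c (hf x)
  | succ i ih =>
    rw [pow_succ] at hr
    refine mul_differenceIdeal_induction (R := ((orderIdeal σ k (n + (i + 1))).restrictScalars
      k).comap (MonoidAlgebra.linearExtend f)) (fun r hr h => ?_) hr
    have h1 := ih (hf.2 h) hr
    rw [add_assoc, add_comm 1 i] at h1
    have h2 : MonoidAlgebra.linearExtend f ∘ₗ
        LinearMap.mulRight k (MonoidAlgebra.single h (1 : k) - 1) =
        MonoidAlgebra.linearExtend fun x => f (x * h) - f x := by
      ext x : 2
      simp [mul_sub, MonoidAlgebra.linearExtend_single, MonoidAlgebra.single_mul_single]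
    rw [← h2] at h1
    exact h1

variable (θ : M →* MvPowerSeries σ k) (β : M →* M →* M) (q : ℕ)

/-- The character `y ↦ θ (y * β x y ^ q)`. -/
def twistedChar (x : M) : M →* MvPowerSeries σ k where
  toFun y := θ (y * β x y ^ q)
  map_one' := by simp
  map_mul' y z := by simp only [map_mul, mul_pow]; ring

theorem twistedChar_apply (x y : M) :
    twistedChar θ β q x y = θ y * θ (β x y) ^ q := by
  simp [twistedChar]

variable {θ} {q} (hθ : ∀ x, θ x - 1 ∈ orderIdeal σ k 1) (hq : ∀ x, θ x ^ q - 1 ∈ orderIdeal σ k 3)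

include hθ in
theorem lift_mem_orderIdeal {j : ℕ} {r : MonoidAlgebra k M} (hr : r ∈ differenceIdeal k M ^ j) :
    MonoidAlgebra.lift k _ M θ r ∈ orderIdeal σ k j := by
  have h1 : DiffOrderGE j 0 θ := (DiffOrderGE.mul_monoidHom (mem_orderIdeal_zero 1) θ hθ).congr rfl
    fun x => (one_mul _).symm
  have h2 : (MonoidAlgebra.lift k _ M θ).toLinearMap = MonoidAlgebra.linearExtend θ := by
    ext x : 2
    simp [MonoidAlgebra.linearExtend_single]
  have h3 := linearExtend_mem_orderIdeal h1 hr
  rw [← h2, zero_add] at h3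
  exact h3

include hq

/-- For fixed y, bilinearity makes x ↦ θ (β x y) ^ q a character; the order 3 in `hq` drops to 2 by
`monoidHom_sub_one`. -/
theorem diffOrderGE_twistedChar_sub (j : ℕ) (y : M) :
    DiffOrderGE j 2 fun x => twistedChar θ β q x y - θ y := by
  have h : DiffOrderGE j 2 fun x => θ (β x y) ^ q - 1 := DiffOrderGE.monoidHom_sub_one
    ((powMonoidHom q).comp (θ.comp (β.flip y))) fun x => hq (β x y)
  exact ((DiffOrderGE.const (mem_orderIdeal_zero (θ y))).mul h).congr (zero_add 2) fun x => by
    rw [twistedChar_apply]; ring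

include hθ
-- With τ the twisted and θ the plain extension, the value τ - θ at r (y - 1) is (τ r - θ r)(τ y -
-- 1) + θ r (τ y - θ y). The orders are (j + 1) + 1 and j + 2, which is why 2 is needed in the
-- preceding lemma.
theorem diffOrderGE_lift_twistedChar_sub {i j : ℕ} {s : MonoidAlgebra k M}
    (hs : s ∈ differenceIdeal k M ^ j) :
    DiffOrderGE i (j + 1) fun x => MonoidAlgebra.lift k _ M (twistedChar θ β q x) s -
      MonoidAlgebra.lift k _ M θ s := by
  induction j generalizing s with
  | zero =>
    induction s using MonoidAlgebra.induction_linear with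
    | zero => simpa using DiffOrderGE.zero
    | add a b ha hb =>
      exact ((ha (by simp)).add (hb (by simp))).congr rfl fun x => by simp only [map_add]; ring
    | single y c =>
      have h := (DiffOrderGE.const (M := M) (mem_orderIdeal_zero (algebraMap k _ c))).mul
        ((diffOrderGE_twistedChar_sub β hq i y).mono_order one_le_two)
      exact h.congr rfl fun x => by simp [MonoidAlgebra.lift_single, Algebra.smul_def, mul_sub]
  | succ j ih =>
    rw [pow_succ] at hs
    let R : Submodule k (MonoidAlgebra k M) :=
      { carrier := {s | DiffOrderGE i (j + 1 + 1) fun x =>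
          MonoidAlgebra.lift k _ M (twistedChar θ β q x) s - MonoidAlgebra.lift k _ M θ s}
        zero_mem' := by simpa using DiffOrderGE.zero
        add_mem' := by
          intro a b ha hb
          exact (DiffOrderGE.add ha hb).congr rfl fun x => by simp only [map_add]; ring
        smul_mem' := by
          intro c a ha
          exact (DiffOrderGE.mul (DiffOrderGE.const (mem_orderIdeal_zero (algebraMap k _ c)))
            ha).congr (zero_add _) fun x => by simp [Algebra.smul_def, mul_sub] }
    refine mul_differenceIdeal_induction (R := R) (fun r hr y => ?_) hs
    have h1 := diffOrderGE_twistedChar_sub β hq i y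
    have h2 := ih hr
    have h3 := lift_mem_orderIdeal hθ hr
    have h4 := (h1.mono_order one_le_two).add (DiffOrderGE.const (M := M) (hθ y))
    exact ((h2.mul h4).add ((DiffOrderGE.const h3).mul h1)).congr rfl fun x => by
      simp only [map_mul, map_sub, map_one, MonoidAlgebra.lift_single, one_smul]; ring

/-- The error term of the product (see `groupAlgebraToPowerSeries_mul_sub`): s accounts for order j
+ 1, and the i differences in r for i more. -/
theorem linearExtend_twisted_mem {i j : ℕ} {r s : MonoidAlgebra k M}
    (hr : r ∈ differenceIdeal k M ^ i) (hs : s ∈ differenceIdeal k M ^ j) :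
    MonoidAlgebra.linearExtend (fun x => θ x *
      (MonoidAlgebra.lift k _ M (twistedChar θ β q x) s - MonoidAlgebra.lift k _ M θ s)) r ∈
      orderIdeal σ k (i + j + 1) := by
  have h1 : DiffOrderGE i 0 fun x => 1 * θ x :=
    DiffOrderGE.mul_monoidHom (mem_orderIdeal_zero 1) θ hθ
  have h2 := linearExtend_mem_orderIdeal
    (h1.mul (diffOrderGE_lift_twistedChar_sub β hθ hq (i := i) hs)) hr
  rw [show 0 + (j + 1) + i = i + j + 1 by omega] at h2
  simpa only [one_mul] using h2

end Twisted

/-! ### The series `∏ (1 + X s) ^ a s` for `p`-adic integers `a s` -/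

section Binomial

variable {σ : Type*} (p : ℕ) [Fact p.Prime] (k : Type*) [Field k] [CharP k p]

/-- The series `(1 + X s) ^ a` as a function of the `p`-adic integer `a`. -/
def binomialChar (s : σ) : Multiplicative ℤ_[p] →* MvPowerSeries σ k where
  toFun a := PowerSeries.substAlgHom (R := k) (PowerSeries.HasSubst.X s)
    (PowerSeries.map ((ZMod.castHom (dvd_refl p) k).comp PadicInt.toZMod)
      (PowerSeries.binomialSeries ℤ_[p] a.toAdd))
  map_one' := by simp
  map_mul' a b := by simp

theorem binomialChar_one (s : σ) : binomialChar p k s (Multiplicative.ofAdd 1) = 1 + X s := by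
  have h := PowerSeries.binomialSeries_nat (R := ℤ_[p]) (A := ℤ_[p]) 1
  rw [Nat.cast_one, pow_one] at h
  change PowerSeries.substAlgHom (PowerSeries.HasSubst.X s)
    (PowerSeries.map _ (PowerSeries.binomialSeries ℤ_[p] 1)) = _
  rw [h, map_add, map_one, PowerSeries.map_X, map_add, map_one, PowerSeries.substAlgHom_X]

theorem constantCoeff_binomialChar (s : σ) (a : Multiplicative ℤ_[p]) :
    constantCoeff (binomialChar p k s a) = 1 := by
  set f := PowerSeries.map ((ZMod.castHom (dvd_refl p) k).comp PadicInt.toZMod)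
      (PowerSeries.binomialSeries ℤ_[p] a.toAdd) with hf
  have hf1 : PowerSeries.constantCoeff (f - 1) = 0 := by
    rw [map_sub, map_one, sub_eq_zero, hf, ← PowerSeries.coeff_zero_eq_constantCoeff_apply,
      PowerSeries.coeff_map, PowerSeries.coeff_zero_eq_constantCoeff_apply,
      PowerSeries.binomialSeries_constantCoeff, map_one]
  have h := PowerSeries.constantCoeff_subst_eq_zero (a := (X s : MvPowerSeries σ k))
    (constantCoeff_X s) (f - 1) hf1
  rw [← PowerSeries.coe_substAlgHom (PowerSeries.HasSubst.X s), map_sub, map_one, map_sub,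
    map_one, sub_eq_zero] at h
  exact h

variable [Fintype σ]

variable (σ) in
/-- The series `∏ (1 + X s) ^ a s` as a function of the vector `a` of `p`-adic integers. -/
def binomialProd : Multiplicative (σ → ℤ_[p]) →* MvPowerSeries σ k where
  toFun a := ∏ s, binomialChar p k s (Multiplicative.ofAdd (a.toAdd s))
  map_one' := by simp
  map_mul' a b := by simp [Finset.prod_mul_distrib]

/-- The standard basis vectors of `ℤ_p ^ σ`. -/
def stdVec [DecidableEq σ] (s : σ) : Multiplicative (σ → ℤ_[p]) :=
  Multiplicative.ofAdd (Pi.single s 1)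

theorem binomialProd_stdVec [DecidableEq σ] (s : σ) :
    binomialProd σ p k (stdVec p s) = 1 + X s := by
  change ∏ t, binomialChar p k t (Multiplicative.ofAdd (Pi.single (M := fun _ => ℤ_[p]) s 1 t)) = _
  rw [Finset.prod_eq_single s, Pi.single_eq_same, binomialChar_one]
  · intro t _ ht
    rw [Pi.single_eq_of_ne ht, ofAdd_zero, map_one]
  · simp

theorem binomialProd_sub_one_mem (a : Multiplicative (σ → ℤ_[p])) :
    binomialProd σ p k a - 1 ∈ orderIdeal σ k 1 := by
  rw [mem_orderIdeal_one_iff, map_sub, map_one, sub_eq_zero]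
  change constantCoeff (∏ s, binomialChar p k s _) = 1
  rw [map_prod]
  exact Finset.prod_eq_one fun s _ => constantCoeff_binomialChar p k s _

/-- In characteristic p, θ^(p^n) - 1 = (θ - 1)^(p^n). -/
theorem binomialProd_pow_sub_one_mem (a : Multiplicative (σ → ℤ_[p])) (n : ℕ) :
    binomialProd σ p k a ^ p ^ n - 1 ∈ orderIdeal σ k (p ^ n) := by
  have : CharP (MvPowerSeries σ k) p :=
    charP_of_injective_ringHom (f := C) (C_injective (σ := σ) (R := k)) p
  have h := pow_mem_orderIdeal (binomialProd_sub_one_mem p k a) (p ^ n)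
  rwa [sub_pow_char_pow, one_pow] at h

end Binomial

/-! ### The group algebra of `ℤ_p ^ σ` as a dense subring of the power series ring -/

section GroupAlgebraPi

variable (σ : Type*) [Fintype σ] (p : ℕ) [Fact p.Prime] (k : Type*) [Field k] [CharP k p]

/-- The embedding of the group algebra of `ℤ_p ^ σ` in the power series ring that sends `single a`
to `∏ (1 + X s) ^ a s`. -/
def toPowerSeries : MonoidAlgebra k (Multiplicative (σ → ℤ_[p])) →ₐ[k] MvPowerSeries σ k :=
  MonoidAlgebra.lift k _ _ (binomialProd σ p k)

omit [CharP k p] in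
/-- The kernel of the reduction `k[ℤ_p ^ σ] → k[(ℤ / p ^ n) ^ σ]`. -/
def powIdeal (n : ℕ) : Ideal (MonoidAlgebra k (Multiplicative (σ → ℤ_[p]))) :=
  relativeAugmentationIdeal k
    (powMonoidHom (p ^ n) : Multiplicative (σ → ℤ_[p]) →* Multiplicative (σ → ℤ_[p])).range

variable {σ p k}

omit [Fintype σ] [CharP k p] in
theorem single_pow_sub_one_mem_powIdeal (n : ℕ) (a : Multiplicative (σ → ℤ_[p])) :
    MonoidAlgebra.single (a ^ p ^ n) (1 : k) - 1 ∈ powIdeal σ p k n := by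
  rw [powIdeal, relativeAugmentationIdeal_eq_span]
  exact Ideal.subset_span ⟨_, ⟨a, rfl⟩, rfl⟩

omit [Fintype σ] [CharP k p] in
theorem powIdeal_antitone : Antitone (powIdeal σ p k) := by
  intro m n h
  refine relativeAugmentationIdeal_mono k ?_
  rintro _ ⟨a, rfl⟩
  refine ⟨a ^ p ^ (n - m), ?_⟩
  rw [powMonoidHom_apply, powMonoidHom_apply, ← pow_mul, ← pow_add, Nat.sub_add_cancel h]

theorem toPowerSeries_single (a : Multiplicative (σ → ℤ_[p])) (c : k) :
    toPowerSeries σ p k (MonoidAlgebra.single a c) = c • binomialProd σ p k a :=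
  MonoidAlgebra.lift_single _ _ _

theorem toPowerSeries_mem_of_mem_powIdeal {n : ℕ}
    {r : MonoidAlgebra k (Multiplicative (σ → ℤ_[p]))} (hr : r ∈ powIdeal σ p k n) :
    toPowerSeries σ p k r ∈ orderIdeal σ k (p ^ n) := by
  rw [powIdeal, relativeAugmentationIdeal_eq_span] at hr
  change r ∈ (orderIdeal σ k (p ^ n)).comap (toPowerSeries σ p k)
  refine Ideal.span_le.2 ?_ hr
  rintro _ ⟨_, ⟨a, rfl⟩, rfl⟩
  change toPowerSeries σ p k _ ∈ orderIdeal σ k (p ^ n)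
  rw [map_sub, map_one, MonoidAlgebra.of_apply, toPowerSeries_single, one_smul, powMonoidHom_apply,
    map_pow]
  exact binomialProd_pow_sub_one_mem p k a n

open Classical in
variable (σ p k) in
/-- The homomorphism from the polynomial ring to the group algebra of `ℤ_p ^ σ` that sends the
variable `X s` to `single e_s - 1`. -/
def polyEval : MvPolynomial σ k →ₐ[k] MonoidAlgebra k (Multiplicative (σ → ℤ_[p])) :=
  MvPolynomial.aeval fun s => MonoidAlgebra.single (stdVec p s) 1 - 1

open Classical in
omit [Fintype σ] [CharP k p] in
theorem polyEval_X (s : σ) :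
    polyEval σ p k (MvPolynomial.X s) = MonoidAlgebra.single (stdVec p s) 1 - 1 :=
  MvPolynomial.aeval_X _ _

theorem toPowerSeries_polyEval (q : MvPolynomial σ k) :
    toPowerSeries σ p k (polyEval σ p k q) = q := by
  have h : (toPowerSeries σ p k).comp (polyEval σ p k) =
      MvPolynomial.coeToMvPowerSeries.algHom k := by
    ext1 s
    classical
    rw [AlgHom.comp_apply, polyEval_X, map_sub, map_one, toPowerSeries_single,
      binomialProd_stdVec]
    simp
  exact (DFunLike.congr_fun h q).trans (by simp)

-- Modulo p^n every p-adic integer is a natural number, so every group element becomes a product of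
-- powers of the 1 + X_s.
omit [CharP k p] in
theorem exists_sub_polyEval_mem_powIdeal (n : ℕ)
    (r : MonoidAlgebra k (Multiplicative (σ → ℤ_[p]))) :
    ∃ q, r - polyEval σ p k q ∈ powIdeal σ p k n := by
  classical
  induction r using MonoidAlgebra.induction_linear with
  | zero => exact ⟨0, by simp⟩
  | add a b ha hb =>
    obtain ⟨q, hq⟩ := ha
    obtain ⟨q', hq'⟩ := hb
    refine ⟨q + q', ?_⟩
    rw [map_add, add_sub_add_comm]
    exact Ideal.add_mem _ hq hq'
  | single a c =>
    have h1 : ∀ s, ∃ z, a.toAdd s = (a.toAdd s).appr n + p ^ n * z := by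
      intro s
      obtain ⟨z, hz⟩ := Ideal.mem_span_singleton.1 (PadicInt.appr_spec n (a.toAdd s))
      exact ⟨z, by rw [← hz]; ring⟩
    choose z hz using h1
    let m : Multiplicative (σ → ℤ_[p]) := ∏ s, stdVec p s ^ (a.toAdd s).appr n
    have ha : a = m * (Multiplicative.ofAdd z) ^ p ^ n := by
      apply Multiplicative.toAdd.injective
      ext1 s
      rw [hz s]
      simp only [m, stdVec, toAdd_mul, toAdd_prod, toAdd_pow, toAdd_ofAdd, Pi.add_apply,
        Finset.sum_apply, Pi.smul_apply]
      rw [Finset.sum_eq_single s]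
      · simp
      · intro t _ ht
        simp [Pi.single_eq_of_ne ht.symm]
      · simp
    refine ⟨MvPolynomial.C c * ∏ s, (1 + MvPolynomial.X s) ^ (a.toAdd s).appr n, ?_⟩
    have h2 : polyEval σ p k (MvPolynomial.C c * ∏ s, (1 + MvPolynomial.X s) ^ (a.toAdd s).appr n)
        = MonoidAlgebra.single m c := by
      have h3 : ∀ s, polyEval σ p k ((1 + MvPolynomial.X s) ^ (a.toAdd s).appr n) =
          MonoidAlgebra.of k _ (stdVec p s ^ (a.toAdd s).appr n) := by
        intro s
        rw [map_pow, map_add, map_one, polyEval_X, add_sub_cancel, map_pow]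
        rfl
      rw [map_mul, map_prod, Finset.prod_congr rfl fun s _ => h3 s, ← map_prod,
        ← MvPolynomial.algebraMap_eq, AlgHom.commutes, MonoidAlgebra.of_apply,
        ← Algebra.smul_def, MonoidAlgebra.smul_single, smul_eq_mul, mul_one]
    have h4 : MonoidAlgebra.single a c - MonoidAlgebra.single m c = MonoidAlgebra.single m c *
        (MonoidAlgebra.single ((Multiplicative.ofAdd z) ^ p ^ n) 1 - 1) := by
      rw [mul_sub, mul_one, MonoidAlgebra.single_mul_single, mul_one, ← ha]
    rw [h2, h4]
    exact Ideal.mul_mem_left _ _ (single_pow_sub_one_mem_powIdeal n _)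

omit [Fintype σ] in
theorem coe_mem_orderIdeal_iff {i : ℕ} {q : MvPolynomial σ k} :
    (q : MvPowerSeries σ k) ∈ orderIdeal σ k i ↔ q ∈ MvPolynomial.idealOfVars σ k ^ i := by
  rw [mem_orderIdeal_iff_coeff, MvPolynomial.mem_pow_idealOfVars_iff]
  refine forall_congr' fun α => ?_
  rw [MvPolynomial.coeff_coe, MvPolynomial.mem_support_iff, ← not_imp_not, not_lt]

omit [Fintype σ] [CharP k p] in
theorem polyEval_mem_differenceIdeal_pow {i : ℕ} {q : MvPolynomial σ k}
    (hq : q ∈ MvPolynomial.idealOfVars σ k ^ i) :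
    polyEval σ p k q ∈ differenceIdeal k (Multiplicative (σ → ℤ_[p])) ^ i := by
  have h : (MvPolynomial.idealOfVars σ k).map (polyEval σ p k) ≤
      differenceIdeal k (Multiplicative (σ → ℤ_[p])) := by
    rw [Ideal.map_le_iff_le_comap, MvPolynomial.idealOfVars, Ideal.span_le]
    rintro _ ⟨s, rfl⟩
    classical
    change polyEval σ p k (MvPolynomial.X s) ∈ differenceIdeal k (Multiplicative (σ → ℤ_[p]))
    rw [polyEval_X]
    exact Ideal.subset_span ⟨_, rfl⟩
  refine Ideal.pow_right_mono h i ?_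
  rw [← Ideal.map_pow]
  exact Ideal.mem_map_of_mem _ hq

/-- Pigeonhole: a monomial of degree above |σ| p^n contains some X_s^(p^n), whose image is `stdVec p
s ^ p ^ n` minus 1. -/
theorem polyEval_mem_powIdeal {n : ℕ} {q : MvPolynomial σ k}
    (hq : (q : MvPowerSeries σ k) ∈ orderIdeal σ k (Fintype.card σ * p ^ n + 1)) :
    polyEval σ p k q ∈ powIdeal σ p k n := by
  classical
  rw [coe_mem_orderIdeal_iff, MvPolynomial.mem_pow_idealOfVars_iff] at hq
  rw [q.as_sum, map_sum]
  refine Ideal.sum_mem _ fun α hα => ?_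
  obtain ⟨s, hs⟩ : ∃ s, p ^ n ≤ α s := by
    by_contra! h
    have h1 := hq α hα
    rw [Finsupp.degree_eq_sum] at h1
    have h2 : ∑ s, α s ≤ ∑ _s : σ, p ^ n := Finset.sum_le_sum fun s _ => (h s).le
    rw [Finset.sum_const, Finset.card_univ, smul_eq_mul] at h2
    omega
  have h1 : MvPolynomial.monomial α (q.coeff α) =
      MvPolynomial.monomial (α - Finsupp.single s (p ^ n)) (q.coeff α) *
        MvPolynomial.X s ^ p ^ n := by
    rw [← MvPolynomial.monomial_add_single, tsub_add_cancel_of_le]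
    rwa [Finsupp.single_le_iff]
  have : CharP (MonoidAlgebra k (Multiplicative (σ → ℤ_[p]))) p :=
    charP_of_injective_algebraMap (algebraMap k _).injective p
  rw [h1, map_mul, map_pow, polyEval_X, sub_pow_char_pow, one_pow, MonoidAlgebra.single_pow,
    one_pow]
  exact Ideal.mul_mem_left _ _ (single_pow_sub_one_mem_powIdeal n _)

theorem mem_powIdeal_of_toPowerSeries_mem {n : ℕ}
    {r : MonoidAlgebra k (Multiplicative (σ → ℤ_[p]))}
    (hr : toPowerSeries σ p k r ∈ orderIdeal σ k (Fintype.card σ * p ^ n + 1)) :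
    r ∈ powIdeal σ p k n := by
  set N := Fintype.card σ * p ^ n + 1
  -- As p^N ≥ N, this precision makes q agree with the series of r up to order N.
  obtain ⟨q, hq⟩ := exists_sub_polyEval_mem_powIdeal (max n N) r
  have h1 := toPowerSeries_mem_of_mem_powIdeal hq
  rw [map_sub, toPowerSeries_polyEval] at h1
  have h2 : (q : MvPowerSeries σ k) ∈ orderIdeal σ k N := by
    rw [← sub_sub_cancel (toPowerSeries σ p k r) (q : MvPowerSeries σ k)]
    exact Ideal.sub_mem _ hr (orderIdeal_antitone ((le_max_right n N).trans
      (Nat.lt_pow_self (Fact.out : p.Prime).one_lt).le) h1)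
  rw [← sub_add_cancel r (polyEval σ p k q)]
  exact Ideal.add_mem _ (powIdeal_antitone (le_max_left _ _) hq) (polyEval_mem_powIdeal h2)

/-- Trades order, visible in the power series, for membership in a power of the difference ideal,
where the difference estimates apply. -/
theorem exists_sub_mem_powIdeal_of_toPowerSeries_mem {i : ℕ}
    {r : MonoidAlgebra k (Multiplicative (σ → ℤ_[p]))}
    (hr : toPowerSeries σ p k r ∈ orderIdeal σ k i) {n : ℕ} (hn : i ≤ p ^ n) :
    ∃ r' ∈ differenceIdeal k (Multiplicative (σ → ℤ_[p])) ^ i, r - r' ∈ powIdeal σ p k n := by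
  obtain ⟨q, hq⟩ := exists_sub_polyEval_mem_powIdeal n r
  have h1 := toPowerSeries_mem_of_mem_powIdeal hq
  rw [map_sub, toPowerSeries_polyEval] at h1
  refine ⟨polyEval σ p k q, polyEval_mem_differenceIdeal_pow (coe_mem_orderIdeal_iff.1 ?_), hq⟩
  rw [← sub_sub_cancel (toPowerSeries σ p k r) (q : MvPowerSeries σ k)]
  exact Ideal.sub_mem _ hr (orderIdeal_antitone hn h1)

end GroupAlgebraPi

/-! ### Completions identified with power series rings -/

section CompletionEquiv

variable {σ k R : Type*} [Field k] [Ring R] [Algebra k R]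

/-- The linear map `ψ` identifies the topology defined by the ideals `I n` with that of a dense
subspace of the power series ring. -/
structure IsDenseFilteredEmbedding (I : ℕ → Ideal R) (ψ : R →ₗ[k] MvPowerSeries σ k) : Prop where
  mem_orderIdeal : ∀ n, ∀ r ∈ I n, ψ r ∈ orderIdeal σ k n
  mem_ideal : ∀ n, ∃ N, ∀ r, ψ r ∈ orderIdeal σ k N → r ∈ I n
  dense : ∀ f N, ∃ r, ψ r - f ∈ orderIdeal σ k N

namespace IsDenseFilteredEmbedding

variable {I : ℕ → Ideal R} [∀ n, (I n).IsTwoSided] (hI : Antitone I)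
  {ψ : R →ₗ[k] MvPowerSeries σ k} (hψ : IsDenseFilteredEmbedding I ψ)
include hψ

theorem exists_limit (x : Completion k I hI) :
    ∃ f, ∀ n r, Completion.proj k I hI n x = Ideal.Quotient.mk (I n) r →
      ψ r - f ∈ orderIdeal σ k n := by
  choose t ht using fun n => Ideal.Quotient.mk_surjective (Completion.proj k I hI n x)
  -- Coefficients of degree m are already determined at level m + 1.
  let f : MvPowerSeries σ k := fun α => coeff α (ψ (t (α.degree + 1)))
  refine ⟨f, fun n r hr => mem_orderIdeal_iff_coeff.2 fun α hα => ?_⟩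
  have h1 : t (α.degree + 1) - r ∈ I (α.degree + 1) := by
    rw [← Ideal.Quotient.eq, ht, ← Completion.factor_proj k I hI (Nat.succ_le_of_lt hα), hr]
    rfl
  have h2 := mem_orderIdeal_iff_coeff.1 (hψ.mem_orderIdeal _ _ h1) α (Nat.lt_succ_self _)
  rw [map_sub, map_sub, sub_eq_zero] at h2
  rw [map_sub, sub_eq_zero, ← h2]
  rfl

omit hψ in
theorem eq_of_forall_sub_mem {x : Completion k I hI} {f g : MvPowerSeries σ k}
    (hf : ∀ n r, Completion.proj k I hI n x = Ideal.Quotient.mk (I n) r →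
      ψ r - f ∈ orderIdeal σ k n)
    (hg : ∀ n r, Completion.proj k I hI n x = Ideal.Quotient.mk (I n) r →
      ψ r - g ∈ orderIdeal σ k n) : f = g := by
  rw [← sub_eq_zero]
  refine eq_zero_of_forall_mem_orderIdeal fun n => ?_
  obtain ⟨r, hr⟩ := Ideal.Quotient.mk_surjective (Completion.proj k I hI n x)
  rw [← sub_sub_sub_cancel_left g f (ψ r)]
  exact Ideal.sub_mem _ (hg n r hr.symm) (hf n r hr.symm)

/-- The extension of `ψ` to the completion. -/
def extend : Completion k I hI →ₗ[k] MvPowerSeries σ k where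
  toFun x := (hψ.exists_limit hI x).choose
  map_add' x y := by
    refine eq_of_forall_sub_mem hI (hψ.exists_limit hI (x + y)).choose_spec fun n r hr => ?_
    obtain ⟨s, hs⟩ := Ideal.Quotient.mk_surjective (Completion.proj k I hI n x)
    have h1 := (hψ.exists_limit hI x).choose_spec n s hs.symm
    have h2 := (hψ.exists_limit hI y).choose_spec n (r - s) (by
      rw [map_sub, ← hr, hs, map_add, add_sub_cancel_left])
    convert Ideal.add_mem _ h1 h2 using 1
    rw [map_sub]
    ring
  map_smul' c x := by
    refine eq_of_forall_sub_mem hI (hψ.exists_limit hI (c • x)).choose_spec fun n r hr => ?_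
    obtain ⟨s, hs⟩ := Ideal.Quotient.mk_surjective (Completion.proj k I hI n x)
    have h1 := smul_mem_orderIdeal c ((hψ.exists_limit hI x).choose_spec n s hs.symm)
    have h2 : r - c • s ∈ I n := by
      rw [← Ideal.Quotient.eq, ← hr, map_smul, ← hs]
      rfl
    convert Ideal.add_mem _ h1 (hψ.mem_orderIdeal n _ h2) using 1
    rw [map_sub, map_smul, smul_sub, RingHom.id_apply]
    ring

theorem sub_extend_mem {n : ℕ} {x : Completion k I hI} {r : R}
    (h : Completion.proj k I hI n x = Ideal.Quotient.mk (I n) r) :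
    ψ r - hψ.extend hI x ∈ orderIdeal σ k n := (hψ.exists_limit hI x).choose_spec n r h

theorem extend_of (r : R) : hψ.extend hI (Completion.of k I hI r) = ψ r := by
  rw [eq_comm, ← sub_eq_zero]
  exact eq_zero_of_forall_mem_orderIdeal fun n => hψ.sub_extend_mem hI rfl

theorem extend_injective : Function.Injective (hψ.extend hI) := by
  rw [injective_iff_map_eq_zero]
  intro x hx
  ext n
  obtain ⟨N, hN⟩ := hψ.mem_ideal n
  obtain ⟨r, hr⟩ := Ideal.Quotient.mk_surjective (Completion.proj k I hI (max n N) x)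
  have h1 := hψ.sub_extend_mem hI hr.symm
  rw [hx, sub_zero] at h1
  have h2 := hN r (orderIdeal_antitone (le_max_right n N) h1)
  rw [map_zero, ← Completion.factor_proj k I hI (le_max_left n N), ← hr]
  exact Ideal.Quotient.eq_zero_iff_mem.2 h2

theorem extend_surjective : Function.Surjective (hψ.extend hI) := by
  intro f
  choose N hN using hψ.mem_ideal
  -- The precision exceeds N m for all m ≤ n, for compatibility modulo I m, and is at least n, for
  -- convergence to f.
  choose t ht using fun n => hψ.dense f (n + ∑ i ∈ Finset.range (n + 1), N i)
  have hle : ∀ m n, m ≤ n → N m ≤ n + ∑ i ∈ Finset.range (n + 1), N i := fun m n h =>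
    (Finset.single_le_sum (f := N) (fun _ _ => Nat.zero_le _)
      (Finset.mem_range.2 (Nat.lt_succ_of_le h))).trans (Nat.le_add_left _ _)
  let x : Completion k I hI := ⟨fun n => Ideal.Quotient.mk (I n) (t n), by
    intro m n h
    change Ideal.Quotient.mk (I m) (t n) = Ideal.Quotient.mk (I m) (t m)
    rw [Ideal.Quotient.eq]
    refine hN m _ ?_
    rw [map_sub, ← sub_sub_sub_cancel_right _ _ f]
    exact Ideal.sub_mem _ (orderIdeal_antitone (hle m n h) (ht n))
      (orderIdeal_antitone (hle m m le_rfl) (ht m))⟩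
  refine ⟨x, ?_⟩
  rw [← sub_eq_zero]
  refine eq_zero_of_forall_mem_orderIdeal fun n => ?_
  rw [← sub_sub_sub_cancel_left f (hψ.extend hI x) (ψ (t n))]
  exact Ideal.sub_mem _ (orderIdeal_antitone (Nat.le_add_right _ _) (ht n))
    (hψ.sub_extend_mem hI rfl)

/-- The identification of the completion with the power series ring. -/
def equiv : Completion k I hI ≃ₗ[k] MvPowerSeries σ k :=
  LinearEquiv.ofBijective (hψ.extend hI) ⟨hψ.extend_injective hI, hψ.extend_surjective hI⟩

theorem equiv_of (r : R) : hψ.equiv hI (Completion.of k I hI r) = ψ r := hψ.extend_of hI r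

theorem sub_equiv_mem {n : ℕ} {x : Completion k I hI} {r : R}
    (h : Completion.proj k I hI n x = Ideal.Quotient.mk (I n) r) :
    ψ r - hψ.equiv hI x ∈ orderIdeal σ k n := hψ.sub_extend_mem hI h

theorem isFilteredMul_equiv (h : ∀ i j r s, ψ r ∈ orderIdeal σ k i → ψ s ∈ orderIdeal σ k j →
    ψ (r * s) - ψ r * ψ s ∈ orderIdeal σ k (i + j + 1)) : IsFilteredMul (hψ.equiv hI) := by
  intro i j x y hx hy
  obtain ⟨r, hr⟩ := Ideal.Quotient.mk_surjective (Completion.proj k I hI (i + j + 1) x)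
  obtain ⟨s, hs⟩ := Ideal.Quotient.mk_surjective (Completion.proj k I hI (i + j + 1) y)
  have h1 := hψ.sub_equiv_mem hI hr.symm
  have h2 := hψ.sub_equiv_mem hI hs.symm
  have h3 := hψ.sub_equiv_mem hI (n := i + j + 1) (x := x * y) (r := r * s) (by
    rw [map_mul, map_mul, hr, hs])
  have hr' : ψ r ∈ orderIdeal σ k i :=
    (Submodule.sub_mem_iff_left _ hx).1 (orderIdeal_antitone (by omega) h1)
  have hs' : ψ s ∈ orderIdeal σ k j :=
    (Submodule.sub_mem_iff_left _ hy).1 (orderIdeal_antitone (by omega) h2)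
  convert Ideal.add_mem _ (Ideal.sub_mem _ (h i j r s hr' hs') h3)
    (Ideal.add_mem _ (Ideal.mul_mem_right (ψ s) _ h1)
      (Ideal.mul_mem_left _ (hψ.equiv hI x) h2)) using 1
  ring

theorem mem_idealClosure_iff {J : Ideal R} (hJ : ∀ r, r ∈ J ↔ ψ r ∈ orderIdeal σ k 1)
    (x : Completion k I hI) :
    x ∈ Completion.idealClosure k I hI J ↔ hψ.equiv hI x ∈ orderIdeal σ k 1 := by
  change x ∈ closure _ ↔ _
  rw [Completion.mem_closure_iff]
  constructor
  · intro h
    obtain ⟨_, ⟨r, hr, rfl⟩, hrx⟩ := h 1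
    exact (Submodule.sub_mem_iff_right _ ((hJ r).1 hr)).1 (hψ.sub_equiv_mem hI hrx.symm)
  · intro h n
    -- Level n + 1 forces r to have order at least 1 even when n = 0.
    obtain ⟨r, hr⟩ := Ideal.Quotient.mk_surjective (Completion.proj k I hI (n + 1) x)
    refine ⟨_, ⟨r, (hJ r).2 ?_, rfl⟩, ?_⟩
    · exact (Submodule.sub_mem_iff_left _ h).1
        (orderIdeal_antitone (Nat.le_add_left 1 n) (hψ.sub_equiv_mem hI hr.symm))
    · rw [← Completion.factor_proj k I hI (Nat.le_succ n) x, ← hr]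
      rfl

end IsDenseFilteredEmbedding

end CompletionEquiv

/-! ### Matrix coordinates on the congruence subgroups -/

/-- The ideal is the kernel of the linear push-forward to cosets, so a bijection matching the coset
partitions suffices; `e` need not be a homomorphism. -/
theorem mem_relativeAugmentationIdeal_iff_mapDomain {k G H : Type*} [Field k] [Group G] [Group H]
    (e : G ≃ H) (N : Subgroup G) [N.Normal] (N' : Subgroup H) [N'.Normal]
    (h : ∀ a b, a⁻¹ * b ∈ N ↔ (e a)⁻¹ * e b ∈ N') (r : MonoidAlgebra k G) :
    r ∈ relativeAugmentationIdeal k N ↔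
      MonoidAlgebra.mapDomainLinearEquiv k k e r ∈ relativeAugmentationIdeal k N' := by
  let f : G ⧸ N → H ⧸ N' := Quotient.map' e fun a b hab => by
    rw [QuotientGroup.leftRel_apply] at hab ⊢
    exact (h a b).1 hab
  have hf : Function.Injective f := by
    intro x y
    induction x using QuotientGroup.induction_on with | _ a
    induction y using QuotientGroup.induction_on with | _ b
    intro hxy
    exact QuotientGroup.eq.2 ((h a b).2 (QuotientGroup.eq.1 hxy))
  have h1 : MonoidAlgebra.mapDomain (QuotientGroup.mk' N')
      (MonoidAlgebra.mapDomainLinearEquiv k k e r) =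
      MonoidAlgebra.mapDomain f (MonoidAlgebra.mapDomain (QuotientGroup.mk' N) r) := by
    induction r using MonoidAlgebra.induction_linear with
    | zero => simp
    | add a b ha hb => simp only [map_add, MonoidAlgebra.mapDomain_add, ha, hb]
    | single g c =>
      simp only [MonoidAlgebra.mapDomainLinearEquiv_single, MonoidAlgebra.mapDomain_single]
      rfl
  rw [relativeAugmentationIdeal, relativeAugmentationIdeal, RingHom.mem_ker, RingHom.mem_ker,
    MonoidAlgebra.mapDomainRingHom_apply, MonoidAlgebra.mapDomainRingHom_apply, h1,
    ← MonoidAlgebra.mapDomain_zero f, (MonoidAlgebra.mapDomain_injective hf).eq_iff]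

section Coordinates

variable (p d u : ℕ) [Fact p.Prime]

/-- The vectors of coordinates of `d × d` matrices over `ℤ_p`. -/
abbrev MatrixVec : Type := Multiplicative (Fin d × Fin d → ℤ_[p])

variable {p d} in
/-- The matrix with given coordinates. -/
def MatrixVec.toMatrix (a : MatrixVec p d) : Matrix (Fin d) (Fin d) ℤ_[p] :=
  Matrix.of fun i j => a.toAdd (i, j)

/-- Matrix multiplication, in coordinates. -/
def matrixPairing : MatrixVec p d →* MatrixVec p d →* MatrixVec p d where
  toFun a :=
    { toFun := fun b => Multiplicative.ofAdd fun s => (a.toMatrix * b.toMatrix) s.1 s.2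
      map_one' := by
        apply Multiplicative.toAdd.injective
        ext s
        simp [Matrix.mul_apply, MatrixVec.toMatrix]
      map_mul' := fun b c => by
        apply Multiplicative.toAdd.injective
        ext s
        simp [Matrix.mul_apply, MatrixVec.toMatrix, mul_add, Finset.sum_add_distrib] }
  map_one' := by
    refine MonoidHom.ext fun b => ?_
    apply Multiplicative.toAdd.injective
    ext s
    simp [Matrix.mul_apply, MatrixVec.toMatrix]
  map_mul' a b := by
    refine MonoidHom.ext fun c => ?_
    apply Multiplicative.toAdd.injective
    ext s
    simp [Matrix.mul_apply, MatrixVec.toMatrix, add_mul, Finset.sum_add_distrib]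

/-- The group law in coordinates: (1 + qA)(1 + qB) = 1 + q(A + B + qAB). -/
theorem toMatrix_mul_mul_pairing_pow (a b : MatrixVec p d) (q : ℕ) :
    (a * b * matrixPairing p d a b ^ q).toMatrix =
      a.toMatrix + b.toMatrix + (q : ℤ_[p]) • (a.toMatrix * b.toMatrix) := by
  ext i j
  simp [MatrixVec.toMatrix, matrixPairing]

variable {d u} (hu : 0 < u)

include hu in
theorem exists_congruenceSubgroup_coe_eq (a : MatrixVec p d) : ∃ g : congruenceSubgroup p d u,
    (g.1 : Matrix (Fin d) (Fin d) ℤ_[p]) = 1 + (p : ℤ_[p]) ^ u • a.toMatrix := by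
  obtain ⟨g, hg, h⟩ := exists_mem_congruenceSubgroup p d u hu
    (1 + (p : ℤ_[p]) ^ u • a.toMatrix) fun i j => by simp
  exact ⟨⟨g, hg⟩, h⟩

theorem exists_coe_eq (g : congruenceSubgroup p d u) : ∃ a : MatrixVec p d,
    (g.1 : Matrix (Fin d) (Fin d) ℤ_[p]) = 1 + (p : ℤ_[p]) ^ u • a.toMatrix := by
  choose z hz using (mem_congruenceSubgroup_iff p d u g.1).1 g.2
  refine ⟨Multiplicative.ofAdd fun s => z s.1 s.2, ?_⟩
  rw [← sub_eq_iff_eq_add']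
  ext i j
  rw [hz]
  simp [MatrixVec.toMatrix]

theorem toMatrix_injective : Function.Injective (MatrixVec.toMatrix (p := p) (d := d)) := by
  intro a b h
  apply Multiplicative.toAdd.injective
  ext s
  exact congr_fun (congr_fun h s.1) s.2

theorem prime_pow_ne_zero : (p : ℤ_[p]) ^ u ≠ 0 :=
  pow_ne_zero _ (Nat.cast_ne_zero.2 (Fact.out : p.Prime).ne_zero)

theorem smul_toMatrix_injective :
    Function.Injective fun a : MatrixVec p d => 1 + (p : ℤ_[p]) ^ u • a.toMatrix :=
  (add_right_injective 1).comp ((smul_right_injective _ (prime_pow_ne_zero p)).comp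
    (toMatrix_injective p))

/-- The coordinates of `(g - 1) / p ^ u`, for `g` in the congruence subgroup of level `p ^ u`. -/
def congruenceCoord : congruenceSubgroup p d u ≃ MatrixVec p d where
  toFun g := (exists_coe_eq p g).choose
  invFun a := (exists_congruenceSubgroup_coe_eq p hu a).choose
  left_inv g := by
    apply Subtype.ext
    apply Units.ext
    rw [(exists_congruenceSubgroup_coe_eq p hu _).choose_spec,
      ← (exists_coe_eq p g).choose_spec]
  right_inv a := by
    apply smul_toMatrix_injective p (u := u)
    dsimp only
    rw [← (exists_coe_eq p _).choose_spec, (exists_congruenceSubgroup_coe_eq p hu a).choose_spec]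

theorem coe_eq_congruenceCoord (g : congruenceSubgroup p d u) :
    (g.1 : Matrix (Fin d) (Fin d) ℤ_[p]) =
      1 + (p : ℤ_[p]) ^ u • (congruenceCoord p hu g).toMatrix :=
  (exists_coe_eq p g).choose_spec

theorem congruenceCoord_eq_iff (g : congruenceSubgroup p d u) (a : MatrixVec p d) :
    congruenceCoord p hu g = a ↔
      (g.1 : Matrix (Fin d) (Fin d) ℤ_[p]) = 1 + (p : ℤ_[p]) ^ u • a.toMatrix := by
  rw [coe_eq_congruenceCoord p hu]
  exact (smul_toMatrix_injective p (u := u)).eq_iff.symm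

theorem congruenceCoord_one : congruenceCoord p hu (1 : congruenceSubgroup p d u) = 1 := by
  rw [congruenceCoord_eq_iff]
  ext i j
  simp [MatrixVec.toMatrix]

theorem congruenceCoord_mul (g h : congruenceSubgroup p d u) :
    congruenceCoord p hu (g * h) = congruenceCoord p hu g * congruenceCoord p hu h *
      matrixPairing p d (congruenceCoord p hu g) (congruenceCoord p hu h) ^ p ^ u := by
  rw [congruenceCoord_eq_iff, toMatrix_mul_mul_pairing_pow]
  change (g.1 : Matrix (Fin d) (Fin d) ℤ_[p]) * (h.1 : Matrix (Fin d) (Fin d) ℤ_[p]) = _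
  rw [coe_eq_congruenceCoord p hu g, coe_eq_congruenceCoord p hu h]
  simp only [mul_add, add_mul, mul_one, one_mul, smul_add, Matrix.smul_mul, Matrix.mul_smul,
    Nat.cast_pow]
  abel

/-- Both conditions say that g and h are congruent modulo p^(u+n); comparing reductions avoids
computing an inverse. -/
theorem inv_mul_mem_subgroupOf_iff (n : ℕ) (g h : congruenceSubgroup p d u) :
    g⁻¹ * h ∈ (congruenceSubgroup p d (u + n)).subgroupOf (congruenceSubgroup p d u) ↔
      (congruenceCoord p hu g)⁻¹ * congruenceCoord p hu h ∈
        (powMonoidHom (p ^ n) : MatrixVec p d →* MatrixVec p d).range := by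
  have h1 : g⁻¹ * h ∈ (congruenceSubgroup p d (u + n)).subgroupOf (congruenceSubgroup p d u) ↔
      ∀ i j, (p : ℤ_[p]) ^ n ∣ (congruenceCoord p hu h).toAdd (i, j) -
        (congruenceCoord p hu g).toAdd (i, j) := by
    rw [Subgroup.mem_subgroupOf, Subgroup.coe_mul, Subgroup.coe_inv, congruenceSubgroup,
      ← MonoidHom.eq_iff, Matrix.GeneralLinearGroup.ext_iff]
    refine forall_congr' fun i => forall_congr' fun j => ?_
    rw [Matrix.GeneralLinearGroup.map_apply, Matrix.GeneralLinearGroup.map_apply, ← sub_eq_zero,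
      ← map_sub, toZModPow_eq_zero_iff, coe_eq_congruenceCoord p hu g,
      coe_eq_congruenceCoord p hu h]
    rw [Matrix.add_apply, Matrix.add_apply, add_sub_add_left_eq_sub, Matrix.smul_apply,
      Matrix.smul_apply, smul_eq_mul, smul_eq_mul, ← mul_sub, pow_add,
      mul_dvd_mul_iff_left (prime_pow_ne_zero p)]
    rfl
  rw [h1]
  constructor
  · intro h
    choose z hz using h
    refine ⟨Multiplicative.ofAdd fun s => z s.1 s.2, ?_⟩
    apply Multiplicative.toAdd.injective
    ext s
    have := hz s.1 s.2
    simp only [powMonoidHom_apply, toAdd_pow, toAdd_ofAdd, toAdd_mul, toAdd_inv, Pi.smul_apply,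
      Pi.add_apply, Pi.neg_apply, nsmul_eq_mul, Nat.cast_pow]
    rw [← this]
    ring
  · rintro ⟨a, ha⟩ i j
    refine ⟨a.toAdd (i, j), ?_⟩
    have := congr_fun (congr_arg Multiplicative.toAdd ha) (i, j)
    simp only [powMonoidHom_apply, toAdd_pow, toAdd_mul, toAdd_inv, Pi.smul_apply,
      Pi.add_apply, Pi.neg_apply, nsmul_eq_mul, Nat.cast_pow] at this
    rw [this]
    ring

end Coordinates

/-! ### The completed group algebra -/

section CompletedGroupAlgebra

variable (p : ℕ) {d u : ℕ} [Fact p.Prime] (hu : 0 < u) (k : Type*) [Field k] [CharP k p]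

/-- The linear map from the group algebra of the congruence subgroup of level `p ^ u` to the power
series ring, given by the coordinates `(g - 1) / p ^ u`. -/
def groupAlgebraToPowerSeries : MonoidAlgebra k (congruenceSubgroup p d u) →ₗ[k]
    MvPowerSeries (Fin d × Fin d) k :=
  (toPowerSeries (Fin d × Fin d) p k).toLinearMap ∘ₗ
    (MonoidAlgebra.mapDomainLinearEquiv k k (congruenceCoord p hu)).toLinearMap

theorem groupAlgebraToPowerSeries_apply (r : MonoidAlgebra k (congruenceSubgroup p d u)) :
    groupAlgebraToPowerSeries p hu k r = toPowerSeries (Fin d × Fin d) p k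
      (MonoidAlgebra.mapDomainLinearEquiv k k (congruenceCoord p hu) r) := rfl

theorem groupAlgebraToPowerSeries_single (g : congruenceSubgroup p d u) (c : k) :
    groupAlgebraToPowerSeries p hu k (MonoidAlgebra.single g c) =
      c • binomialProd _ p k (congruenceCoord p hu g) := by
  rw [groupAlgebraToPowerSeries_apply, MonoidAlgebra.mapDomainLinearEquiv_single,
    toPowerSeries_single]

theorem groupAlgebraToPowerSeries_one : groupAlgebraToPowerSeries p hu k
    (1 : MonoidAlgebra k (congruenceSubgroup p d u)) = 1 := by
  rw [MonoidAlgebra.one_def, groupAlgebraToPowerSeries_single, congruenceCoord_one, map_one,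
    one_smul]

omit [CharP k p] in
theorem mem_congruenceIdeal_iff (n : ℕ) (r : MonoidAlgebra k (congruenceSubgroup p d u)) :
    r ∈ congruenceIdeal k p d u n ↔
      MonoidAlgebra.mapDomainLinearEquiv k k (congruenceCoord p hu) r ∈ powIdeal _ p k n :=
  mem_relativeAugmentationIdeal_iff_mapDomain _ _ _ (inv_mul_mem_subgroupOf_iff p hu n) r

theorem isDenseFilteredEmbedding_groupAlgebraToPowerSeries :
    IsDenseFilteredEmbedding (congruenceIdeal k p d u) (groupAlgebraToPowerSeries p hu k) where
  mem_orderIdeal n r hr := orderIdeal_antitone (Nat.lt_pow_self (Fact.out : p.Prime).one_lt).le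
    (toPowerSeries_mem_of_mem_powIdeal ((mem_congruenceIdeal_iff p hu k n r).1 hr))
  mem_ideal n := ⟨_, fun r hr =>
    (mem_congruenceIdeal_iff p hu k n r).2 (mem_powIdeal_of_toPowerSeries_mem hr)⟩
  dense f N := by
    classical
    let q := truncFinset k (Finsupp.finite_of_degree_lt (σ := Fin d × Fin d) N).toFinset f
    refine ⟨(MonoidAlgebra.mapDomainLinearEquiv k k (congruenceCoord p hu)).symm
      (polyEval _ p k q), ?_⟩
    rw [groupAlgebraToPowerSeries_apply, LinearEquiv.apply_symm_apply, toPowerSeries_polyEval,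
      mem_orderIdeal_iff_coeff]
    intro α hα
    rw [map_sub, MvPolynomial.coeff_coe, coeff_truncFinset, if_pos (by simpa using hα), sub_self]

theorem mem_augmentationIdeal_iff (r : MonoidAlgebra k (congruenceSubgroup p d u)) :
    r ∈ augmentationIdeal k (congruenceSubgroup p d u) ↔
      groupAlgebraToPowerSeries p hu k r ∈ orderIdeal _ k 1 := by
  rw [mem_orderIdeal_one_iff, augmentationIdeal, RingHom.mem_ker]
  have h : MonoidAlgebra.lift k k (congruenceSubgroup p d u) 1 r =
      constantCoeff (groupAlgebraToPowerSeries p hu k r) := by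
    induction r using MonoidAlgebra.induction_linear with
    | zero => simp
    | add a b ha hb => rw [map_add, map_add, map_add, ha, hb]
    | single g c =>
      have h1 := binomialProd_sub_one_mem p k (congruenceCoord p hu g)
      rw [mem_orderIdeal_one_iff, map_sub, map_one, sub_eq_zero] at h1
      rw [groupAlgebraToPowerSeries_single, MonoidAlgebra.lift_single, constantCoeff_smul, h1,
        MonoidHom.one_apply]
  rw [← h]

/-- Both sides are bilinear, and on group elements the identity is θ(A ∘ B) = θ(A) · τ_A(B), with
τ_A the twisted character. -/
theorem groupAlgebraToPowerSeries_mul_sub (r s : MonoidAlgebra k (congruenceSubgroup p d u)) :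
    groupAlgebraToPowerSeries p hu k (r * s) -
      groupAlgebraToPowerSeries p hu k r * groupAlgebraToPowerSeries p hu k s =
    MonoidAlgebra.linearExtend (fun x => binomialProd _ p k x *
      (MonoidAlgebra.lift k _ _
        (twistedChar (binomialProd _ p k) (matrixPairing p d) (p ^ u) x)
          (MonoidAlgebra.mapDomainLinearEquiv k k (congruenceCoord p hu) s) -
        MonoidAlgebra.lift k _ _ (binomialProd _ p k)
          (MonoidAlgebra.mapDomainLinearEquiv k k (congruenceCoord p hu) s)))
      (MonoidAlgebra.mapDomainLinearEquiv k k (congruenceCoord p hu) r) := by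
  induction r using MonoidAlgebra.induction_linear with
  | zero => simp
  | add a b ha hb =>
    rw [map_add, map_add, map_add, ← ha, ← hb, add_mul, add_mul, map_add]
    ring
  | single g c =>
    rw [MonoidAlgebra.mapDomainLinearEquiv_single, MonoidAlgebra.linearExtend_single]
    induction s using MonoidAlgebra.induction_linear with
    | zero => simp
    | add a b ha hb =>
      rw [mul_add, map_add, map_add, mul_add, add_sub_add_comm, ha, hb, map_add, map_add, map_add,
        ← smul_add]
      congr 1
      ring
    | single h c' =>
      rw [MonoidAlgebra.single_mul_single, MonoidAlgebra.mapDomainLinearEquiv_single,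
        MonoidAlgebra.lift_single, MonoidAlgebra.lift_single, groupAlgebraToPowerSeries_single,
        groupAlgebraToPowerSeries_single, groupAlgebraToPowerSeries_single, congruenceCoord_mul,
        twistedChar_apply]
      simp only [map_mul, map_pow, Algebra.smul_def]
      ring

-- The point where p = 2 requires u ≥ 2. For p = 2 and u = 1 the element g = -1 of Γ satisfies (g -
-- 1)² = 0 in k[Γ].
include hu in
theorem three_le_prime_pow (hu2 : p = 2 → 2 ≤ u) : 3 ≤ p ^ u := by
  have hp := (Fact.out : p.Prime).two_le
  rcases hp.eq_or_lt with h | h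
  · subst h
    exact (by norm_num : 3 ≤ 2 ^ 2).trans (Nat.pow_le_pow_right two_pos (hu2 rfl))
  · exact h.trans_le (Nat.le_self_pow hu.ne' p)

theorem groupAlgebraToPowerSeries_mul_sub_mem (hu2 : p = 2 → 2 ≤ u) (i j : ℕ)
    (r s : MonoidAlgebra k (congruenceSubgroup p d u))
    (hr : groupAlgebraToPowerSeries p hu k r ∈ orderIdeal _ k i)
    (hs : groupAlgebraToPowerSeries p hu k s ∈ orderIdeal _ k j) :
    groupAlgebraToPowerSeries p hu k (r * s) -
      groupAlgebraToPowerSeries p hu k r * groupAlgebraToPowerSeries p hu k s ∈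
        orderIdeal _ k (i + j + 1) := by
  set n := i + j + 1
  set e := MonoidAlgebra.mapDomainLinearEquiv k k (congruenceCoord p hu (d := d)) with he
  have hn : n ≤ p ^ n := (Nat.lt_pow_self (Fact.out : p.Prime).one_lt).le
  have approx : ∀ (m : ℕ) (t : MonoidAlgebra k (congruenceSubgroup p d u)), m ≤ n →
      groupAlgebraToPowerSeries p hu k t ∈ orderIdeal _ k m →
      -- An error at level n has order at least n = i + j + 1, so r and s may be replaced by such
      -- approximations.
      ∃ t', e t' ∈ differenceIdeal k (MatrixVec p d) ^ m ∧ t - t' ∈ congruenceIdeal k p d u n := by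
    intro m t hm ht
    obtain ⟨t', ht', h⟩ := exists_sub_mem_powIdeal_of_toPowerSeries_mem (n := n) ht (hm.trans hn)
    refine ⟨e.symm t', by rwa [LinearEquiv.apply_symm_apply], ?_⟩
    rw [mem_congruenceIdeal_iff p hu, map_sub, ← he, LinearEquiv.apply_symm_apply]
    exact h
  obtain ⟨r', hr', hrr⟩ := approx i r (by omega) hr
  obtain ⟨s', hs', hss⟩ := approx j s (by omega) hs
  have hD := (isDenseFilteredEmbedding_groupAlgebraToPowerSeries (d := d) p hu k).mem_orderIdeal n
  have h1 := linearExtend_twisted_mem (matrixPairing p d) (binomialProd_sub_one_mem p k)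
    (fun x => orderIdeal_antitone (three_le_prime_pow p hu hu2)
      (binomialProd_pow_sub_one_mem p k x u)) hr' hs'
  rw [he, ← groupAlgebraToPowerSeries_mul_sub] at h1
  have h2 := hD (r * s - r' * s') (by
    rw [show r * s - r' * s' = (r - r') * s + r' * (s - s') by noncomm_ring]
    exact Ideal.add_mem _ (Ideal.mul_mem_right _ _ hrr) (Ideal.mul_mem_left _ _ hss))
  have h3 := hD _ hrr
  have h4 := hD _ hss
  rw [map_sub] at h2 h3 h4
  convert Ideal.sub_mem _ (Ideal.add_mem _ h1 h2) (Ideal.add_mem _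
    (Ideal.mul_mem_right (groupAlgebraToPowerSeries p hu k s) _ h3)
    (Ideal.mul_mem_left _ (groupAlgebraToPowerSeries p hu k r') h4)) using 1
  ring

end CompletedGroupAlgebra

end

/-! ### The graded ring and ring-theoretic properties of k[[Γ]] -/

theorem theorem4p3 (p d u : ℕ) [Fact p.Prime] (hd : 0 < d) (hu : 0 < u) (hu2 : p = 2 → 2 ≤ u)
    (k : Type*) [Field k] [CharP k p] :
    (∀ x : CompletedGroupAlgebra k p d u,
      (∀ n : ℕ, x ∈ closedAugmentationIdeal k p d u ^ n) → x = 0) ∧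
    (∃ φ : Gr (closedAugmentationIdeal k p d u) ≃ₐ[k] MvPolynomial (Fin (d ^ 2)) k,
      ∀ (i : ℕ) (x : GrPiece (closedAugmentationIdeal k p d u) i),
        (φ (DirectSum.of (GrPiece (closedAugmentationIdeal k p d u)) i x)).IsHomogeneous i) ∧
    IsDomain (CompletedGroupAlgebra k p d u) ∧
    IsNoetherianRing (CompletedGroupAlgebra k p d u) ∧
    IsNoetherianRing (CompletedGroupAlgebra k p d u)ᵐᵒᵖ := by
  have hψ := isDenseFilteredEmbedding_groupAlgebraToPowerSeries (d := d) p hu k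
  have hΨ := hψ.isFilteredMul_equiv (congruenceIdeal_antitone k p d u)
    (groupAlgebraToPowerSeries_mul_sub_mem p hu k hu2)
  have hω := hψ.mem_idealClosure_iff (congruenceIdeal_antitone k p d u)
    (mem_augmentationIdeal_iff p hu k)
  have h1 : hψ.equiv (congruenceIdeal_antitone k p d u) 1 = 1 := by
    rw [← map_one (Completion.of k (congruenceIdeal k p d u) (congruenceIdeal_antitone k p d u)),
      hψ.equiv_of, groupAlgebraToPowerSeries_one]
  refine ⟨fun x hx => hΨ.eq_zero_of_forall_mem_pow hω hx, ?_, hΨ.isDomain, hΨ.isNoetherianRing,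
    hΨ.op.isNoetherianRing⟩
  obtain ⟨φ, hφ⟩ := hΨ.exists_algEquiv_gr hω h1
  let e : Fin d × Fin d ≃ Fin (d ^ 2) := finProdFinEquiv.trans (finCongr (sq d).symm)
  exact ⟨φ.trans (MvPolynomial.renameEquiv k e), fun i x =>
    (hφ i x).rename_isHomogeneous⟩
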